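/- Let $G$ be a locally compact second countable (Hausdorff) group. A \emph{$G$-space} $(X,\nu)$ is a standard Borel space $X$ with a measurable action of $G$ and a probability measure $\nu$ whose class of null sets is preserved by every $g\in G$. A \emph{$G$-map} $\pi:(X,\nu)\to(Y,\eta)$ of $G$-spaces is a measurable map with $\pi_*\nu=\eta$ such that, for every $g\in G$, $\pi(gx)=g\pi(x)$ for $\nu$-almost every $x$. A \emph{disintegration} of $\nu$ over $\eta$ along $\pi$ is a measurable map $D_\pi:Y\to P(X)$, unique up to $\eta$-null sets, such that $D_\pi(y)$ is concentrated on $\pi^{-1}(y)$ for $\eta$-almost every $y$ and $\int_Y D_\pi(y)\,d\eta(y)=\nu$; its conjugates are $D_\pi^{(g)}(y)=g^{-1}D_\pi(gy)$, where $g\mu(E)=\mu(g^{-1}E)$. The $G$-map $\pi$ is \emph{relatively contractive} if, for every version $D_\pi$ of the disintegration, for $\eta$-almost every $y\in Y$ and every measurable $B\subseteq X$ with $D_\pi(y)(B)>0$ one has $\sup_{g\in G}D_\pi^{(g)}(y)(B)=1$. A \emph{continuous compact model} of $\pi$ is a continuous $G$-map $\pi_0:(X_0,\nu_0)\to(Y_0,\eta_0)$,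 where $X_0$ and $Y_0$ are compact metric spaces with continuous $G$-actions $G\times X_0\to X_0$, $G\times Y_0\to Y_0$ and Borel probability measures $\nu_0,\eta_0$ of full support, such that there are measurable isomorphisms of $G$-spaces (defined almost everywhere) $\varphi:(X,\nu)\to(X_0,\nu_0)$ and $\psi:(Y,\eta)\to(Y_0,\eta_0)$ with $\pi_0\circ\varphi=\psi\circ\pi$ $\nu$-almost everywhere. The model is \emph{relatively contractible} if, for every version $D_{\pi_0}$ of the disintegration of $\nu_0$ over $\eta_0$ along $\pi_0$, for $\eta_0$-almost every $y\in Y_0$ and every $x$ in the (closed) support of $D_{\pi_0}(y)$ there is a sequence $(g_n)$ in $G$ such that $D_{\pi_0}^{(g_n)}(y)=g_n^{-1}D_{\pi_0}(g_ny)\to\delta_x$ in the weak* topology. \textbf{Theorem.} Let $\pi:(X,\nu)\to(Y,\eta)$ be a $G$-map of $G$-spaces. Then $\pi$ is relatively contractive if and only if every continuous compact model of $\pi$ is relatively contractible. -/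

import Mathlib

open MeasureTheory ProbabilityTheory Filter Topology

universe w

section GSpaces

variable (G : Type*) [Group G] [MeasurableSpace G]
  {X : Type*} [MeasurableSpace X] [MulAction G X]

/-- The measure `ν` makes `X` (with the given action) a `G`-space: `ν` is a probability measure,
the action is a measurable action, and every group element preserves the class of null sets.
(That `X` is standard Borel is assumed separately, as a type class.) -/
structure IsGSpace (ν : Measure X) : Prop where
  isProbabilityMeasure : IsProbabilityMeasure ν
  measurable_smul : Measurable (fun p : G × X => p.1 • p.2)
  quasiInvariant : ∀ g : G, Measure.QuasiMeasurePreserving (fun x : X => g • x) ν ν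

end GSpaces

section GMaps

variable (G : Type*) [Group G]
  {X : Type*} [MeasurableSpace X] [MulAction G X]
  {Y : Type*} [MeasurableSpace Y] [MulAction G Y]

/-- `π : (X, ν) → (Y, η)` is a `G`-map: it is measurable, pushes `ν` to `η`, and for every `g` it
satisfies `π (g x) = g π(x)` for almost every `x`. -/
structure IsGMap (ν : Measure X) (η : Measure Y) (π : X → Y) : Prop where
  measurable : Measurable π
  map_eq : ν.map π = η
  equivariant : ∀ g : G, ∀ᵐ x ∂ν, π (g • x) = g • π x

/-- `φ : (X, ν) → (Y, η)` is a measurable isomorphism of `G`-spaces, defined almost everywhere: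
a `G`-map with a measurable inverse modulo null sets. -/
structure IsGIso (ν : Measure X) (η : Measure Y) (φ : X → Y) : Prop where
  isGMap : IsGMap G ν η φ
  exists_inverse : ∃ ψ : Y → X, Measurable ψ ∧
    (∀ᵐ x ∂ν, ψ (φ x) = x) ∧ (∀ᵐ y ∂η, φ (ψ y) = y)

/-- `D` is a (version of the) disintegration of `ν` over `η` along `π`: a measurable family of
probability measures `D y` on `X`, concentrated on the fibre `π ⁻¹ {y}` for almost every `y`, with
`∫ D y dη(y) = ν`. -/
structure IsDisintegration (ν : Measure X) (η : Measure Y) (π : X → Y) (D : Kernel Y X) :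
    Prop where
  isMarkovKernel : IsMarkovKernel D
  concentrated : ∀ᵐ y ∂η, ∀ᵐ x ∂(D y), π x = y
  bind_eq : η.bind D = ν

variable {G}

/-- The conjugated disintegration measure `g⁻¹ D(g y)`. -/
noncomputable def conjDisintegration (D : Kernel Y X) (g : G) (y : Y) : Measure X :=
  (D (g • y)).map (fun x : X => g⁻¹ • x)

variable (G)

/-- `π : (X, ν) → (Y, η)` is relatively contractive. A disintegration is only determined almost
everywhere, so the condition is required of each version of it. -/
def RelativelyContractive (ν : Measure X) (η : Measure Y) (π : X → Y) : Prop :=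
  ∀ D : Kernel Y X, IsDisintegration ν η π D →
    ∀ᵐ y ∂η, ∀ B : Set X, MeasurableSet B → 0 < D y B →
      ⨆ g : G, conjDisintegration D g y B = 1

end GMaps

section Models

variable (G : Type*) [Group G] [TopologicalSpace G] [MeasurableSpace G]

/-- A map `π : (X, ν) → (Y, η)` of compact metric `G`-spaces is relatively contractible: for almost
every `y`, each point mass `δ_x` with `x` in the (closed) support of `D y` is the weak* limit of
a sequence `gₙ⁻¹ D(gₙ y)`. Again each version `D` of the disintegration is meant. -/
def RelativelyContractible {X Y : Type*} [MetricSpace X] [MeasurableSpace X] [MulAction G X]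
    [MeasurableSpace Y] [MulAction G Y] (ν : Measure X) (η : Measure Y) (π : X → Y) : Prop :=
  ∀ D : Kernel Y X, IsDisintegration ν η π D →
    ∀ᵐ y ∂η, ∀ x ∈ (D y).support, ∃ g : ℕ → G, ∀ f : C(X, ℝ),
      Tendsto (fun n => ∫ z, f z ∂(conjDisintegration D (g n) y)) atTop (𝓝 (f x))

/-- The compact metric space `X₀` with its `G`-action and the measure `ν₀` is a point realization
(compact model) of `(X, ν)` through the almost everywhere defined isomorphism `φ`. -/
structure IsPointRealization {X X₀ : Type*} [MeasurableSpace X] [MulAction G X]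
    [MetricSpace X₀] [CompactSpace X₀] [MeasurableSpace X₀] [BorelSpace X₀] [MulAction G X₀]
    (ν : Measure X) (ν₀ : Measure X₀) (φ : X → X₀) : Prop where
  continuousSMul : ContinuousSMul G X₀
  isGSpace : IsGSpace G ν₀
  fullSupport : ν₀.IsOpenPosMeasure
  isGIso : IsGIso G ν ν₀ φ

/-- The map `π₀ : (X₀, ν₀) → (Y₀, η₀)` is a point realization (continuous compact model) of
`π : (X, ν) → (Y, η)`: it is a continuous `G`-map between point realizations of the two spaces, and
the square formed by `π`, `π₀` and the two isomorphisms commutes almost everywhere. -/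
structure IsPointRealizationMap {X Y X₀ Y₀ : Type*}
    [MeasurableSpace X] [MulAction G X] [MeasurableSpace Y] [MulAction G Y]
    [MetricSpace X₀] [CompactSpace X₀] [MeasurableSpace X₀] [BorelSpace X₀] [MulAction G X₀]
    [MetricSpace Y₀] [CompactSpace Y₀] [MeasurableSpace Y₀] [BorelSpace Y₀] [MulAction G Y₀]
    (ν : Measure X) (η : Measure Y) (π : X → Y)
    (ν₀ : Measure X₀) (η₀ : Measure Y₀) (π₀ : X₀ → Y₀) : Prop where
  continuous : Continuous π₀
  isGMap : IsGMap G ν₀ η₀ π₀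
  exists_iso : ∃ (φ : X → X₀) (ψ : Y → Y₀),
    IsPointRealization G ν ν₀ φ ∧ IsPointRealization G η η₀ ψ ∧
      ∀ᵐ x ∂ν, π₀ (φ x) = ψ (π x)

end Models

/-!
The disintegration is only determined almost everywhere, while both conditions of the theorem take
a supremum over all of `G`, which a version may change on null sets of group elements. Both are
therefore compared with a third condition, `EssContracts`: for almost every `y`, the essential
supremum over `g` (for Haar measure) of the means of a function `f` with respect to `g⁻¹ D(g y)` is
at least the essential supremum of `f` with respect to `D y`. By Fubini's theorem this condition
passes along isomorphisms that are equivariant almost everywhere (`essContracts_iff_of_map`).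

Versions. If `f` is continuous along orbits, a suitable version `D'` turns an almost sure bound on
these means into a bound for every `g` (`exists_version_forall_le`). Hence relative contractivity
gives essential contraction of functions continuous along orbits, and relative contractibility of
a compact model gives it for continuous functions on that model.

Regularisation. For a continuous density `ρ` with compact support, the average
`orbitAverage ρ φ x = ∫ ρ h * φ (h • x)` is continuous along orbits, with a modulus of continuity
that depends on `ρ` only. These averages converge to `φ` almost everywhere as `ρ` shrinks to the
identity, and it follows that essential contraction of all averages gives it for all `φ`
(`essContracts_of_orbitAverage`).

Models. The functions `G → [0, 1]` with a given modulus of continuity form a compact metrizable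
`G`-space (`OrbitFunctions`). Sending a point to countably many averages along its orbit maps `X`
and `Y` equivariantly, and almost everywhere injectively, to products of such spaces. The supports
of the image measures form a compact model in which a prescribed average has become a continuous
function (`essContracts_orbitAverage_of_models`).

Sets depending on the fibre. Relative contractivity concerns all sets `B` at once, and a set for
which it fails may depend on `y`. Such sets are approximated within a countable algebra, where they
can be chosen measurably. As the constraints are convex, a Hilbert space argument turns the
approximations into one function on `X` that violates essential contraction
(`exists_measurable_selection`, `ae_iSup_conjDisintegration_eq_one`).

So relative contractivity gives essential contraction of all functions, whence, in any model, the
convergence to point masses (`ae_forall_mem_support_exists_tendsto`). Conversely, contractibility of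
all models gives essential contraction of all functions, whence relative contractivity.
-/

set_option linter.unusedSectionVars false

/-! ### Null sets along orbits -/

section NullSets

variable {G : Type*} [Group G] [TopologicalSpace G] [IsTopologicalGroup G]
  [LocallyCompactSpace G] [SecondCountableTopology G] [MeasurableSpace G] [BorelSpace G]
  {X : Type*} [MeasurableSpace X] [MulAction G X] [MeasurableSMul₂ G X]
  {Y : Type*} [MeasurableSpace Y] [MulAction G Y] [MeasurableSMul₂ G Y]

variable (G) in
/-- A right Haar measure on `G`. Right invariance makes the modulus of continuity of an average
`x ↦ ∫ ρ h * φ (h • x)` along an orbit invariant under the action. -/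
noncomputable def rightHaar : Measure G := (Measure.haar : Measure G).inv

instance : (rightHaar G).IsMulRightInvariant := by unfold rightHaar; infer_instance

instance : SigmaFinite (rightHaar G) := by unfold rightHaar; infer_instance

instance : (rightHaar G).IsOpenPosMeasure := by unfold rightHaar; infer_instance

instance : IsFiniteMeasureOnCompacts (rightHaar G) := by unfold rightHaar; infer_instance

instance : NeZero (rightHaar G) :=
  ⟨fun h => (isOpen_univ (X := G)).measure_ne_zero (rightHaar G) Set.univ_nonempty (by simp [h])⟩

variable (G) in
/-- A probability measure on `G` with the null sets of Haar measure. -/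
noncomputable def haarProb : Measure G := (rightHaar G).toFinite

instance : IsProbabilityMeasure (haarProb G) := by unfold haarProb; infer_instance

theorem ae_haarProb : ae (haarProb G) = ae (rightHaar G) := ae_toFinite

theorem measurable_smul_prod : Measurable (fun p : G × Y => p.1 • p.2) :=
  measurable_fst.smul measurable_snd

/-- The kernel `(g, y) ↦ g⁻¹ D(g y)`. -/
noncomputable def conjKernel (D : Kernel Y X) : Kernel (G × Y) X :=
  ((Kernel.deterministic (fun p : G × Y => p.1) measurable_fst) ×ₖ
    (D.comap (fun p : G × Y => p.1 • p.2) measurable_smul_prod)).map (fun q : G × X => q.1⁻¹ • q.2)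

theorem conjKernel_apply (D : Kernel Y X) [IsSFiniteKernel D] (g : G) (y : Y) :
    conjKernel D (g, y) = conjDisintegration D g y := by
  have hm : Measurable (fun q : G × X => q.1⁻¹ • q.2) :=
    measurable_fst.inv.smul measurable_snd
  rw [conjKernel, Kernel.map_apply _ hm, Kernel.prod_apply, Kernel.deterministic_apply,
    Kernel.comap_apply, Measure.dirac_prod, Measure.map_map hm (by fun_prop)]
  rfl

instance (D : Kernel Y X) [IsMarkovKernel D] : IsMarkovKernel (conjKernel (G := G) D) :=
  Kernel.IsMarkovKernel.map _ (measurable_fst.inv.smul measurable_snd)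

instance (D : Kernel Y X) [IsMarkovKernel D] (g : G) (y : Y) :
    IsProbabilityMeasure (conjDisintegration D g y) := by
  rw [← conjKernel_apply]; infer_instance

theorem integral_conjDisintegration (D : Kernel Y X) {f : X → ℝ} (hf : Measurable f)
    (g : G) (y : Y) :
    ∫ x, f x ∂(conjDisintegration D g y) = ∫ x, f (g⁻¹ • x) ∂(D (g • y)) :=
  integral_map (measurable_const_smul g⁻¹).aemeasurable hf.aestronglyMeasurable

theorem measurable_integral_conjDisintegration (D : Kernel Y X) [IsMarkovKernel D] {f : X → ℝ}
    (hf : Measurable f) :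
    Measurable (fun p : G × Y => ∫ x, f x ∂(conjDisintegration D p.1 p.2)) := by
  simp_rw [← conjKernel_apply]
  exact (StronglyMeasurable.integral_kernel_prod_right
    (f := fun (_ : G × Y) x => f x) (hf.comp measurable_snd).stronglyMeasurable).measurable

theorem ae_smul {ν : Measure X}
    (hν : ∀ g : G, Measure.QuasiMeasurePreserving (fun x : X => g • x) ν ν)
    {p : X → Prop} (h : ∀ᵐ x ∂ν, p x) (g : G) : ∀ᵐ x ∂ν, p (g • x) :=
  (hν g).ae h

/-- A property that holds almost everywhere for every group element holds, for almost every `y`,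
for almost every group element and almost everywhere in the fibre over `g • y`. -/
theorem ae_ae_ae_fibre {ν : Measure X} {η : Measure Y} [SFinite η] {D : Kernel Y X}
    [IsMarkovKernel D]
    (hη : ∀ g : G, Measure.QuasiMeasurePreserving (fun y : Y => g • y) η η)
    (hD : η.bind D = ν) {p : G → X → Prop} (hp : MeasurableSet {q : G × X | p q.1 q.2})
    (h : ∀ g, ∀ᵐ x ∂ν, p g x) :
    ∀ᵐ y ∂η, ∀ᵐ g ∂(rightHaar G), ∀ᵐ x ∂(D (g • y)), p g x := by
  have hms : MeasurableSet {q : G × Y | ∀ᵐ x ∂(D (q.1 • q.2)), p q.1 x} := by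
    let κ : Kernel (G × Y) X := D.comap (fun p : G × Y => p.1 • p.2) measurable_smul_prod
    have h1 : MeasurableSet {r : (G × Y) × X | ¬ p r.1.1 r.2} :=
      (hp.preimage ((measurable_fst.comp measurable_fst).prodMk measurable_snd)).compl
    have h2 := Kernel.measurable_kernel_prodMk_left (κ := κ) h1
    exact h2 (measurableSet_singleton 0)
  refine (Measure.ae_ae_comm (p := fun g y => ∀ᵐ x ∂(D (g • y)), p g x) hms).1
    (Eventually.of_forall fun g => ?_)
  have h3 : ∀ᵐ y ∂η, ∀ᵐ x ∂(D y), p g x := by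
    refine Measure.ae_ae_of_ae_bind D.measurable.aemeasurable ?_
    rw [hD]; exact h g
  exact ae_smul hη h3 g

/-- A `ν`-null set is null, for almost every `y`, for almost all the measures `g⁻¹ D(g y)`. -/
theorem ae_ae_ae_conjDisintegration {ν : Measure X} {η : Measure Y} [SFinite η] {D : Kernel Y X}
    [IsMarkovKernel D]
    (hν : ∀ g : G, Measure.QuasiMeasurePreserving (fun x : X => g • x) ν ν)
    (hη : ∀ g : G, Measure.QuasiMeasurePreserving (fun y : Y => g • y) η η)
    (hD : η.bind D = ν) {p : X → Prop} (h : ∀ᵐ x ∂ν, p x) :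
    ∀ᵐ y ∂η, ∀ᵐ g ∂(rightHaar G), ∀ᵐ x ∂(conjDisintegration D g y), p x := by
  obtain ⟨s, hsp, hs, hs0⟩ := exists_measurable_superset_of_null (ae_iff.1 h)
  have hm : Measurable (fun q : G × X => q.1⁻¹ • q.2) := measurable_fst.inv.smul measurable_snd
  have key := ae_ae_ae_fibre (p := fun (g : G) x => g⁻¹ • x ∈ sᶜ) hη hD (hs.compl.preimage hm)
    (fun g => ae_smul hν (p := fun x => x ∈ sᶜ) (by rw [ae_iff]; simpa using hs0) g⁻¹)
  filter_upwards [key] with y hy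
  filter_upwards [hy] with g hg
  have : ∀ᵐ x ∂(conjDisintegration D g y), x ∈ sᶜ :=
    (ae_map_iff (measurable_const_smul g⁻¹).aemeasurable hs.compl).2 hg
  filter_upwards [this] with x hx
  by_contra hc
  exact hx (hsp hc)

theorem ae_ae_smul {ν : Measure X} [SFinite ν]
    (hν : ∀ g : G, Measure.QuasiMeasurePreserving (fun x : X => g • x) ν ν)
    {p : X → Prop} (h : ∀ᵐ x ∂ν, p x) : ∀ᵐ x ∂ν, ∀ᵐ g ∂(rightHaar G), p (g • x) := by
  obtain ⟨s, hsp, hs, hs0⟩ := exists_measurable_superset_of_null (ae_iff.1 h)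
  have key := (Measure.ae_ae_comm (μ := rightHaar G) (ν := ν) (p := fun (g : G) x => g • x ∈ sᶜ)
    (hs.compl.preimage measurable_smul)).1
    (Eventually.of_forall fun g => ae_smul hν (p := fun x => x ∈ sᶜ)
      (by rw [ae_iff]; simpa using hs0) g)
  filter_upwards [key] with y hy
  filter_upwards [hy] with g hg
  by_contra hc
  exact hg (hsp hc)

theorem ae_rightHaar_mul_left {p : G → Prop} (h : ∀ᵐ g ∂(rightHaar G), p g) (k : G) :
    ∀ᵐ g ∂(rightHaar G), p (k * g) :=
  (quasiMeasurePreserving_mul_left (rightHaar G) k).ae h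

theorem ae_rightHaar_mul_right {p : G → Prop} (h : ∀ᵐ g ∂(rightHaar G), p g) (k : G) :
    ∀ᵐ g ∂(rightHaar G), p (g * k) :=
  (eventually_mul_right_iff _ k).2 h

theorem ae_rightHaar_inv {p : G → Prop} (h : ∀ᵐ g ∂(rightHaar G), p g) :
    ∀ᵐ g ∂(rightHaar G), p g⁻¹ :=
  (quasiMeasurePreserving_inv_of_right_invariant (rightHaar G)).ae h

end NullSets

/-! ### Averages along orbits and approximate identities -/

section Averages

variable {G : Type*} [Group G] [TopologicalSpace G] [IsTopologicalGroup G] [T2Space G]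
  [LocallyCompactSpace G] [SecondCountableTopology G] [MeasurableSpace G] [BorelSpace G]
  {X : Type*} [MeasurableSpace X] [MulAction G X] [MeasurableSMul₂ G X]

/-- A continuous compactly supported probability density on `G`. -/
structure IsBump (ρ : G → ℝ) : Prop where
  continuous : Continuous ρ
  hasCompactSupport : HasCompactSupport ρ
  nonneg : ∀ h, 0 ≤ ρ h
  integral_eq_one : ∫ h, ρ h ∂(rightHaar G) = 1

theorem IsBump.integrable {ρ : G → ℝ} (hρ : IsBump ρ) : Integrable ρ (rightHaar G) :=
  hρ.continuous.integrable_of_hasCompactSupport hρ.hasCompactSupport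

theorem exists_isBump {V : Set G} (hV : V ∈ 𝓝 (1 : G)) :
    ∃ ρ : G → ℝ, IsBump ρ ∧ ∀ h ∉ V, ρ h = 0 := by
  obtain ⟨f, hf1, hf0, hfc, hf⟩ := exists_continuous_one_zero_of_isCompact
    (isCompact_singleton (x := (1 : G))) (isOpen_interior (s := V)).isClosed_compl
    (by rw [Set.disjoint_compl_right_iff_subset]; simpa using mem_interior_iff_mem_nhds.2 hV)
  have h1 : f 1 = 1 := by simpa using hf1 (Set.mem_singleton (1 : G))
  have hpos : 0 < ∫ h, f h ∂(rightHaar G) :=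
    f.continuous.integral_pos_of_hasCompactSupport_nonneg_nonzero hfc (fun h => (hf h).1)
      (x := 1) (by rw [h1]; exact one_ne_zero)
  refine ⟨fun h => (∫ h, f h ∂(rightHaar G))⁻¹ * f h, ⟨by fun_prop, hfc.mul_left, fun h =>
    mul_nonneg (inv_nonneg.2 hpos.le) (hf h).1, ?_⟩, fun h hh => ?_⟩
  · rw [integral_const_mul, inv_mul_cancel₀ hpos.ne']
  · have : f h = 0 := by simpa using hf0 (fun hi => hh (interior_subset hi) : h ∈ (interior V)ᶜ)
    simp [this]

/-- The average of `φ` along the orbit of `x`, with density `ρ`. -/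
noncomputable def orbitAverage (ρ : G → ℝ) (φ : X → ℝ) (x : X) : ℝ :=
  ∫ h, ρ h * φ (h • x) ∂(rightHaar G)

theorem measurable_orbitAverage {ρ : G → ℝ} (hρ : Continuous ρ) {φ : X → ℝ} (hφ : Measurable φ) :
    Measurable (orbitAverage ρ φ) := by
  have : Measurable (fun p : X × G => ρ p.2 * φ (p.2 • p.1)) :=
    (hρ.measurable.comp measurable_snd).mul (hφ.comp (measurable_snd.smul measurable_fst))
  exact (this.stronglyMeasurable.integral_prod_right (ν := rightHaar G)).measurable

theorem integrable_mul_of_mem_Icc {Ω : Type*} [MeasurableSpace Ω] {μ : Measure Ω} {ρ v : Ω → ℝ}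
    (hρ : Integrable ρ μ) (hv : Measurable v) (hv1 : ∀ h, v h ∈ Set.Icc (0 : ℝ) 1) :
    Integrable (fun h => ρ h * v h) μ := by
  refine hρ.mono (hρ.aestronglyMeasurable.mul hv.aestronglyMeasurable)
    (Eventually.of_forall fun h => ?_)
  rw [norm_mul, Real.norm_of_nonneg (hv1 h).1]
  exact mul_le_of_le_one_right (norm_nonneg _) (hv1 h).2

theorem IsBump.integrable_mul {ρ : G → ℝ} (hρ : IsBump ρ) {φ : X → ℝ} (hφ : Measurable φ)
    (hφ1 : ∀ x, φ x ∈ Set.Icc (0 : ℝ) 1) (x : X) :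
    Integrable (fun h => ρ h * φ (h • x)) (rightHaar G) :=
  integrable_mul_of_mem_Icc hρ.integrable (hφ.comp (measurable_smul_const x)) fun h => hφ1 (h • x)

theorem IsBump.orbitAverage_mem_Icc {ρ : G → ℝ} (hρ : IsBump ρ) {φ : X → ℝ} (hφ : Measurable φ)
    (hφ1 : ∀ x, φ x ∈ Set.Icc (0 : ℝ) 1) (x : X) : orbitAverage ρ φ x ∈ Set.Icc (0 : ℝ) 1 := by
  refine ⟨integral_nonneg fun h => mul_nonneg (hρ.nonneg h) (hφ1 _).1, ?_⟩
  rw [← hρ.integral_eq_one]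
  exact integral_mono (hρ.integrable_mul hφ hφ1 x) hρ.integrable
    fun h => mul_le_of_le_one_right (hρ.nonneg h) (hφ1 _).2

/-- A modulus of continuity along orbits of the averages with density `ρ`. -/
noncomputable def orbitModulus (ρ : G → ℝ) (g g' : G) : ℝ :=
  ∫ h, |ρ (h * g⁻¹) - ρ (h * g'⁻¹)| ∂(rightHaar G)

theorem orbitModulus_mul_right (ρ : G → ℝ) (g g' k : G) :
    orbitModulus ρ (g * k) (g' * k) = orbitModulus ρ g g' := by
  have := integral_mul_right_eq_self (μ := rightHaar G)
    (fun h => |ρ (h * g⁻¹) - ρ (h * g'⁻¹)|) k⁻¹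
  rw [orbitModulus, orbitModulus, ← this]
  simp only [mul_inv_rev, mul_assoc]

open scoped Pointwise in
theorem IsBump.tendsto_orbitModulus {ρ : G → ℝ} (hρ : IsBump ρ) (g : G) :
    Tendsto (fun g' => orbitModulus ρ g' g) (𝓝 g) (𝓝 0) := by
  obtain ⟨V, hVc, hV⟩ := exists_compact_mem_nhds g
  obtain ⟨C, hC⟩ := hρ.hasCompactSupport.exists_bound_of_continuous hρ.continuous
  set K : Set G := tsupport ρ * V
  have hK : IsCompact K := IsCompact.mul hρ.hasCompactSupport hVc
  have h0 : ∀ g' ∈ V, ∀ h ∉ K, ρ (h * g'⁻¹) = 0 := by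
    intro g' hg' h hh
    by_contra hne
    exact hh ⟨h * g'⁻¹, subset_tsupport _ hne, g', hg', by simp⟩
  have hz : (0 : ℝ) = ∫ h, |ρ (h * g⁻¹) - ρ (h * g⁻¹)| ∂(rightHaar G) := by simp
  rw [hz]
  refine tendsto_integral_filter_of_dominated_convergence (K.indicator fun _ => C + C)
    (Eventually.of_forall fun g' => ?_) ?_ ?_ (Eventually.of_forall fun h => ?_)
  · have := hρ.continuous
    exact (by fun_prop : Continuous fun h => |ρ (h * g'⁻¹) - ρ (h * g⁻¹)|).aestronglyMeasurable
  · filter_upwards [hV] with g' hg'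
    refine Eventually.of_forall fun h => ?_
    by_cases hh : h ∈ K
    · rw [Set.indicator_of_mem hh, Real.norm_eq_abs, abs_abs]
      exact (abs_sub _ _).trans (add_le_add (hC _) (hC _))
    · rw [Set.indicator_of_notMem hh, h0 g' hg' h hh, h0 g (mem_of_mem_nhds hV) h hh]
      simp
  · exact (integrable_indicator_iff hK.measurableSet).2
      (integrableOn_const (hK.measure_lt_top.ne))
  · have := hρ.continuous
    exact (by fun_prop : Continuous fun g' => |ρ (h * g'⁻¹) - ρ (h * g⁻¹)|).tendsto g

theorem orbitAverage_smul (ρ : G → ℝ) (φ : X → ℝ) (g : G) (x : X) :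
    orbitAverage ρ φ (g • x) = ∫ h, ρ (h * g⁻¹) * φ (h • x) ∂(rightHaar G) := by
  rw [← integral_mul_right_eq_self _ g]
  simp [orbitAverage, mul_smul]

theorem IsBump.abs_orbitAverage_sub_le {ρ : G → ℝ} (hρ : IsBump ρ) {φ : X → ℝ} (hφ : Measurable φ)
    (hφ1 : ∀ x, φ x ∈ Set.Icc (0 : ℝ) 1) (x : X) (g g' : G) :
    |orbitAverage ρ φ (g • x) - orbitAverage ρ φ (g' • x)| ≤ orbitModulus ρ g g' := by
  have hi : ∀ k : G, Integrable (fun h => ρ (h * k⁻¹)) (rightHaar G) := fun k =>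
    hρ.integrable.comp_mul_right k⁻¹
  have hi' : ∀ k : G, Integrable (fun h => ρ (h * k⁻¹) * φ (h • x)) (rightHaar G) := fun k =>
    integrable_mul_of_mem_Icc (hi k) (hφ.comp (measurable_smul_const x)) fun h => hφ1 (h • x)
  rw [orbitAverage_smul, orbitAverage_smul, ← integral_sub (hi' g) (hi' g')]
  refine abs_integral_le_integral_abs.trans (integral_mono ((hi' g).sub (hi' g')).abs
    ((hi g).sub (hi g')).abs fun h => ?_)
  simp only [← sub_mul, abs_mul, abs_of_nonneg (hφ1 _).1]
  exact mul_le_of_le_one_right (abs_nonneg _) (hφ1 _).2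

theorem IsBump.continuous_orbitAverage_smul {ρ : G → ℝ} (hρ : IsBump ρ) {φ : X → ℝ}
    (hφ : Measurable φ) (hφ1 : ∀ x, φ x ∈ Set.Icc (0 : ℝ) 1) (x : X) :
    Continuous fun g : G => orbitAverage ρ φ (g • x) := by
  refine continuous_iff_continuousAt.2 fun g => ?_
  rw [ContinuousAt, tendsto_iff_dist_tendsto_zero]
  exact squeeze_zero (fun _ => dist_nonneg)
    (fun g' => hρ.abs_orbitAverage_sub_le hφ hφ1 x g' g) (hρ.tendsto_orbitModulus g)

open scoped Pointwise in
/-- Local `L¹`-continuity of left translation on `G`. -/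
theorem tendsto_lintegral_translate {v : G → ℝ} (hv : Measurable v)
    (hv1 : ∀ g, v g ∈ Set.Icc (0 : ℝ) 1) {K : Set G} (hK : IsCompact K) :
    Tendsto (fun h => ∫⁻ g in K, ‖v (h * g) - v g‖ₑ ∂(Measure.haar : Measure G))
      (𝓝 1) (𝓝 0) := by
  obtain ⟨V, hVc, hV⟩ := exists_compact_mem_nhds (1 : G)
  set C : Set G := V * K
  have hC : IsCompact C := hVc.mul hK
  obtain ⟨w, hwC⟩ : ∃ w : G → ℝ, w = C.indicator v := ⟨_, rfl⟩
  have hwm : Measurable w := hwC ▸ hv.indicator hC.measurableSet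
  have hw : MemLp w 1 (Measure.haar : Measure G) := by
    rw [memLp_one_iff_integrable, hwC]
    refine (integrable_indicator_iff hC.measurableSet).2 ?_
    refine Measure.integrableOn_of_bounded (M := 1) hC.measure_lt_top.ne
      hv.aestronglyMeasurable (Eventually.of_forall fun g => ?_)
    rw [Real.norm_of_nonneg (hv1 g).1]; exact (hv1 g).2
  have : Fact ((1 : ENNReal) ≠ ⊤) := ⟨ENNReal.one_ne_top⟩
  have hc : Tendsto (fun h : G => DomMulAct.mk h • hw.toLp w) (𝓝 1) (𝓝 (hw.toLp w)) := by
    have h1 : Continuous fun h : G => DomMulAct.mk h • hw.toLp w := by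
      have : Continuous fun h : G => DomMulAct.mk h := DomMulAct.continuous_mk
      exact this.smul continuous_const
    have h2 := h1.tendsto 1
    rwa [DomMulAct.mk_one, one_smul] at h2
  rw [tendsto_iff_edist_tendsto_0] at hc
  refine tendsto_of_tendsto_of_tendsto_of_le_of_le' tendsto_const_nhds hc
    (Eventually.of_forall fun _ => zero_le) ?_
  filter_upwards [hV] with h hh
  have he : edist (DomMulAct.mk h • hw.toLp w) (hw.toLp w)
      = ∫⁻ g, ‖w (h * g) - w g‖ₑ ∂(Measure.haar : Measure G) := by
    rw [DomMulAct.mk_smul_toLp, Lp.edist_toLp_toLp, eLpNorm_one_eq_lintegral_enorm]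
    rfl
  rw [he]
  refine le_trans (setLIntegral_mono' hK.measurableSet fun g hg => ?_)
    (setLIntegral_le_lintegral K _)
  have hg1 : h * g ∈ C := Set.mul_mem_mul hh hg
  have hg2 : g ∈ C := ⟨1, mem_of_mem_nhds hV, g, hg, one_mul g⟩
  simp only [hwC, Set.indicator_of_mem hg1, Set.indicator_of_mem hg2, le_refl]

/-- A convolution of `ν` with Haar measure on a compact set: a finite measure dominating `ν` for
which translation is continuous in `L¹`. -/
theorem exists_measure_tendsto_lintegral_smul {ν : Measure X} [IsProbabilityMeasure ν]
    (hν : ∀ g : G, Measure.QuasiMeasurePreserving (fun x : X => g • x) ν ν) :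
    ∃ ν' : Measure X, IsFiniteMeasure ν' ∧ ν ≪ ν' ∧ ∀ φ : X → ℝ, Measurable φ →
      (∀ x, φ x ∈ Set.Icc (0 : ℝ) 1) →
      Tendsto (fun h : G => ∫⁻ x, ‖φ (h • x) - φ x‖ₑ ∂ν') (𝓝 1) (𝓝 0) := by
  obtain ⟨K, hK, hK1⟩ := exists_compact_mem_nhds (1 : G)
  set μ : Measure G := (Measure.haar : Measure G).restrict K
  have : IsFiniteMeasure μ := ⟨by simpa [μ] using hK.measure_lt_top⟩
  have hT : Measurable (fun p : X × G => p.2 • p.1) := measurable_snd.smul measurable_fst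
  refine ⟨(ν.prod μ).map (fun p : X × G => p.2 • p.1), inferInstance, ?_, fun φ hφ hφ1 => ?_⟩
  · refine Measure.AbsolutelyContinuous.mk fun s hs h0 => ?_
    rw [Measure.map_apply hT hs] at h0
    have h1 : ∀ᵐ p ∂(ν.prod μ), p.2 • p.1 ∉ s := by
      rw [ae_iff]; simp only [not_not]; exact h0
    have h2 := Measure.ae_ae_of_ae_prod h1
    have h3 := (Measure.ae_ae_comm (p := fun x (g : G) => g • x ∉ s)
      (hs.compl.preimage hT)).1 h2
    have hμ : μ ≠ 0 := by
      have : (Measure.haar : Measure G) K ≠ 0 :=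
        (Measure.measure_pos_of_mem_nhds _ hK1).ne'
      intro h; apply this
      simpa [μ] using congrArg (fun m => m Set.univ) h
    have : (ae μ).NeBot := ae_neBot.2 hμ
    obtain ⟨g, hg⟩ := h3.exists
    have h4 := ae_smul hν hg g⁻¹
    simp only [smul_inv_smul] at h4
    simpa [ae_iff] using h4
  · have hm : ∀ h : G, Measurable fun x => ‖φ (h • x) - φ x‖ₑ := fun h =>
      ((hφ.comp (measurable_const_smul h)).sub hφ).enorm
    have he : ∀ h : G, ∫⁻ x, ‖φ (h • x) - φ x‖ₑ ∂((ν.prod μ).map fun p : X × G => p.2 • p.1)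
        = ∫⁻ x, ∫⁻ g, ‖φ ((h * g) • x) - φ (g • x)‖ₑ ∂μ ∂ν := by
      intro h
      rw [lintegral_map (hm h) hT,
        lintegral_prod (fun p : X × G => ‖φ (h • p.2 • p.1) - φ (p.2 • p.1)‖ₑ)
          ((hm h).comp hT).aemeasurable]
      simp only [mul_smul]
    simp only [he]
    have hz : (0 : ENNReal) = ∫⁻ _, 0 ∂ν := by simp
    rw [hz]
    refine tendsto_lintegral_filter_of_dominated_convergence (fun _ => μ Set.univ)
      (Eventually.of_forall fun h => ?_) (Eventually.of_forall fun h => ?_) ?_ ?_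
    · refine Measurable.lintegral_prod_right' (f := fun p : X × G =>
        ‖φ ((h * p.2) • p.1) - φ (p.2 • p.1)‖ₑ) ?_
      exact ((hφ.comp ((measurable_snd.const_mul h).smul measurable_fst)).sub (hφ.comp hT)).enorm
    · refine Eventually.of_forall fun x => ?_
      refine (lintegral_mono fun g => ?_).trans_eq (lintegral_one)
      have : ‖φ ((h * g) • x) - φ (g • x)‖ ≤ 1 := by
        rw [Real.norm_eq_abs, abs_le]
        have h1 := hφ1 ((h * g) • x)
        have h2 := hφ1 (g • x)
        constructor <;> linarith [h1.1, h1.2, h2.1, h2.2]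
      rw [← ofReal_norm]
      simpa using ENNReal.ofReal_le_ofReal this
    · simp
    · refine Eventually.of_forall fun x => ?_
      exact tendsto_lintegral_translate (hφ.comp (measurable_smul_const x)) (fun g => hφ1 (g • x)) hK

/-- Averages over small enough neighbourhoods of `1` converge almost everywhere. -/
theorem exists_nhds_tendsto_orbitAverage {ν : Measure X} [IsProbabilityMeasure ν]
    (hν : ∀ g : G, Measure.QuasiMeasurePreserving (fun x : X => g • x) ν ν)
    {φ : X → ℝ} (hφ : Measurable φ) (hφ1 : ∀ x, φ x ∈ Set.Icc (0 : ℝ) 1) :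
    ∃ V : ℕ → Set G, (∀ n, V n ∈ 𝓝 (1 : G)) ∧ ∀ ρ : ℕ → G → ℝ, (∀ n, IsBump (ρ n)) →
      (∀ n, ∀ h ∉ V n, ρ n h = 0) →
      ∀ᵐ x ∂ν, Tendsto (fun n => orbitAverage (ρ n) φ x) atTop (𝓝 (φ x)) := by
  obtain ⟨ν', _, hac, hν'⟩ := exists_measure_tendsto_lintegral_smul hν
  have hpos : ∀ n : ℕ, (0 : ENNReal) < 2⁻¹ ^ n := fun n => ENNReal.pow_pos (by simp) n
  refine ⟨fun n => {h : G | ∫⁻ x, ‖φ (h • x) - φ x‖ₑ ∂ν' < 2⁻¹ ^ n},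
    fun n => (hν' φ hφ hφ1).eventually_lt_const (hpos n), fun ρ hρ hV => hac.ae_le ?_⟩
  have hm : Measurable fun p : X × G => ‖φ (p.2 • p.1) - φ p.1‖ₑ :=
    ((hφ.comp (measurable_snd.smul measurable_fst)).sub (hφ.comp measurable_fst)).enorm
  have hρ1 : ∀ n, ∫⁻ h, ‖ρ n h‖ₑ ∂(rightHaar G) = 1 := by
    intro n
    have := ofReal_integral_eq_lintegral_ofReal (hρ n).integrable
      (Eventually.of_forall (hρ n).nonneg)
    rw [(hρ n).integral_eq_one, ENNReal.ofReal_one] at this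
    rw [this]
    exact lintegral_congr fun h => Real.enorm_of_nonneg ((hρ n).nonneg h)
  have hle : ∀ n x, ‖orbitAverage (ρ n) φ x - φ x‖ₑ
      ≤ ∫⁻ h, ‖ρ n h‖ₑ * ‖φ (h • x) - φ x‖ₑ ∂(rightHaar G) := by
    intro n x
    have h1 : orbitAverage (ρ n) φ x - φ x
        = ∫ h, ρ n h * (φ (h • x) - φ x) ∂(rightHaar G) := by
      simp_rw [mul_sub]
      rw [integral_sub ((hρ n).integrable_mul hφ hφ1 x) ((hρ n).integrable.mul_const _),
        integral_mul_const, (hρ n).integral_eq_one, one_mul]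
      rfl
    rw [h1]
    refine (enorm_integral_le_lintegral_enorm _).trans_eq ?_
    simp_rw [enorm_mul]
  have hint : ∀ n, ∫⁻ x, ‖orbitAverage (ρ n) φ x - φ x‖ₑ ∂ν' ≤ 2⁻¹ ^ n := by
    intro n
    have hm2 : Measurable fun p : X × G => ‖ρ n p.2‖ₑ * ‖φ (p.2 • p.1) - φ p.1‖ₑ :=
      (((hρ n).continuous.measurable.comp measurable_snd).enorm).mul hm
    calc ∫⁻ x, ‖orbitAverage (ρ n) φ x - φ x‖ₑ ∂ν'
        ≤ ∫⁻ x, ∫⁻ h, ‖ρ n h‖ₑ * ‖φ (h • x) - φ x‖ₑ ∂(rightHaar G) ∂ν' :=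
          lintegral_mono (hle n)
      _ = ∫⁻ h, ∫⁻ x, ‖ρ n h‖ₑ * ‖φ (h • x) - φ x‖ₑ ∂ν' ∂(rightHaar G) :=
          lintegral_lintegral_swap hm2.aemeasurable
      _ ≤ ∫⁻ h, ‖ρ n h‖ₑ * 2⁻¹ ^ n ∂(rightHaar G) := by
          refine lintegral_mono fun h => ?_
          have hm4 : Measurable fun x => ‖φ (h • x) - φ x‖ₑ :=
            ((hφ.comp (measurable_const_smul h)).sub hφ).enorm
          rw [lintegral_const_mul _ hm4]
          by_cases hh : ∫⁻ x, ‖φ (h • x) - φ x‖ₑ ∂ν' < 2⁻¹ ^ n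
          · exact mul_le_mul_right hh.le _
          · rw [hV n h hh]; simp
      _ = 2⁻¹ ^ n := by
          rw [lintegral_mul_const _ (hρ n).continuous.measurable.enorm, hρ1, one_mul]
  have hm3 : ∀ n, Measurable fun x => ‖orbitAverage (ρ n) φ x - φ x‖ₑ := fun n =>
    ((measurable_orbitAverage (hρ n).continuous hφ).sub hφ).enorm
  have hsum : ∫⁻ x, ∑' n, ‖orbitAverage (ρ n) φ x - φ x‖ₑ ∂ν' ≠ ⊤ := by
    rw [lintegral_tsum fun n => (hm3 n).aemeasurable]
    refine ne_top_of_le_ne_top ?_ (ENNReal.tsum_le_tsum hint)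
    rw [ENNReal.tsum_geometric]
    simp
  have hae := ae_lt_top (Measurable.tsum hm3) hsum
  filter_upwards [hae] with x hx
  rw [tendsto_iff_edist_tendsto_0]
  simp_rw [edist_eq_enorm_sub]
  exact ENNReal.tendsto_atTop_zero_of_tsum_ne_top hx.ne

end Averages

/-! ### Choosing a version of the disintegration -/

section Versions

variable {G : Type*} [Group G] [TopologicalSpace G] [IsTopologicalGroup G] [T2Space G]
  [LocallyCompactSpace G] [SecondCountableTopology G] [MeasurableSpace G] [BorelSpace G]
  {X : Type*} [MeasurableSpace X] [MulAction G X] [MeasurableSMul₂ G X]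
  {Y : Type*} [MeasurableSpace Y] [MulAction G Y] [MeasurableSMul₂ G Y]

/-- Almost every point of `A` is a density point of `A` along its orbit. -/
theorem ae_measure_return_ne_zero {η : Measure Y} [IsProbabilityMeasure η]
    (hη : ∀ g : G, Measure.QuasiMeasurePreserving (fun y : Y => g • y) η η)
    {A : Set Y} (hA : MeasurableSet A) :
    ∀ᵐ y ∂η, y ∈ A → ∀ U ∈ 𝓝 (1 : G), rightHaar G {h | h ∈ U ∧ h • y ∈ A} ≠ 0 := by
  have hφ : Measurable (A.indicator fun _ => (1 : ℝ)) := measurable_const.indicator hA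
  have hφ1 : ∀ y, A.indicator (fun _ => (1 : ℝ)) y ∈ Set.Icc (0 : ℝ) 1 := fun y => by
    by_cases hy : y ∈ A <;> simp [hy]
  obtain ⟨V, hV, hVρ⟩ := exists_nhds_tendsto_orbitAverage hη hφ hφ1
  obtain ⟨W, hW⟩ := (𝓝 (1 : G)).exists_antitone_basis
  choose ρ hρ hρ0 using fun n => exists_isBump (inter_mem (hV n) (hW.mem n))
  filter_upwards [hVρ ρ hρ fun n h hh => hρ0 n h fun hi => hh hi.1] with y hy hyA U hU h0
  rw [Set.indicator_of_mem hyA] at hy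
  obtain ⟨n, hn1, hn2⟩ := ((hy.eventually_const_lt zero_lt_one).and
    (hW.tendsto_smallSets.eventually (eventually_smallSets_subset.2 hU))).exists
  refine hn1.ne' ?_
  rw [orbitAverage]
  refine integral_eq_zero_of_ae ?_
  have h1 : ∀ᵐ h ∂(rightHaar G), ¬ (h ∈ U ∧ h • y ∈ A) := by
    rw [ae_iff]; simpa using h0
  filter_upwards [h1] with h hh
  by_cases hhU : h ∈ U
  · have : h • y ∉ A := fun hc => hh ⟨hhU, hc⟩
    simp [this]
  · have : ρ n h = 0 := hρ0 n h fun hc => hhU (hn2 hc.2)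
    simp [this]

/-- The kernel averaging the conjugates `h⁻¹ D(h y)` over `h`. -/
noncomputable def averageKernel (G : Type*) [Group G] [TopologicalSpace G] [IsTopologicalGroup G]
    [LocallyCompactSpace G] [SecondCountableTopology G] [MeasurableSpace G] [BorelSpace G]
    [MulAction G X] [MeasurableSMul₂ G X] [MulAction G Y] [MeasurableSMul₂ G Y]
    (D : Kernel Y X) : Kernel Y X :=
  conjKernel (G := G) D ∘ₖ (Kernel.const Y (haarProb G) ×ₖ Kernel.id)

instance (D : Kernel Y X) [IsMarkovKernel D] : IsMarkovKernel (averageKernel G D) := by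
  unfold averageKernel; infer_instance

theorem integral_averageKernel (D : Kernel Y X) [IsMarkovKernel D] {f : X → ℝ} (hf : Measurable f)
    (hf1 : ∀ x, f x ∈ Set.Icc (0 : ℝ) 1) (y : Y) :
    ∫ x, f x ∂(averageKernel G D y) = ∫ h, ∫ x, f x ∂(conjDisintegration D h y) ∂(haarProb G) := by
  have hi : Integrable f (averageKernel G D y) :=
    Integrable.of_mem_Icc 0 1 hf.aemeasurable (Eventually.of_forall hf1)
  rw [averageKernel, Kernel.integral_comp hi, Kernel.prod_apply, Kernel.const_apply,
    Kernel.id_apply, Measure.prod_dirac, integral_map (by fun_prop)]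
  · simp only [conjKernel_apply]
  · exact (StronglyMeasurable.integral_kernel_prod_right
      (f := fun (_ : G × Y) x => f x)
      (hf.comp measurable_snd).stronglyMeasurable).aestronglyMeasurable

/-- For a function `f` continuous along orbits, some version of the disintegration has the property
that an almost sure bound on the `f`-means of its conjugates holds for every group element. The
new version is an average of conjugates of the old one on a null set; elsewhere the bound passes
from almost all group elements to all of them by continuity. -/
theorem exists_version_forall_le {η : Measure Y} [IsProbabilityMeasure η]
    (hη : ∀ g : G, Measure.QuasiMeasurePreserving (fun y : Y => g • y) η η)
    (D : Kernel Y X) [IsMarkovKernel D] {f : X → ℝ} (hf : Measurable f)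
    (hf1 : ∀ x, f x ∈ Set.Icc (0 : ℝ) 1) (hfc : ∀ x, Continuous fun g : G => f (g • x)) (b : ℝ) :
    ∃ D' : Kernel Y X, IsMarkovKernel D' ∧ (∀ᵐ y ∂η, D' y = D y) ∧
      ∀ᵐ y ∂η, (∀ᵐ g ∂(rightHaar G), ∫ x, f x ∂(conjDisintegration D g y) ≤ b) →
        ∀ g : G, ∫ x, f x ∂(conjDisintegration D' g y) ≤ b := by
  classical
  set F : G × Y → ℝ := fun p => ∫ x, f x ∂(conjDisintegration D p.1 p.2) with hF
  have hFm : Measurable F := measurable_integral_conjDisintegration D hf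
  set I : Y → G → ℝ := fun y g => ∫ x, f (g⁻¹ • x) ∂(D y) with hI
  have hFI : ∀ g y, F (g, y) = I (g • y) g := fun g y => integral_conjDisintegration D hf g y
  have hIF : ∀ y g, I y g = F (g, g⁻¹ • y) := fun y g => by rw [hFI, smul_inv_smul]
  have hIm : Measurable fun p : Y × G => I p.1 p.2 := by
    simp_rw [hIF]
    exact hFm.comp (measurable_snd.prodMk (measurable_snd.inv.smul measurable_fst))
  have hIc : ∀ y, Continuous (I y) := by
    intro y
    refine continuous_of_dominated (bound := fun _ => 1) (fun g => ?_) (fun g => ?_)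
      (integrable_const _) (Eventually.of_forall fun x => ?_)
    · exact (hf.comp (measurable_const_smul g⁻¹)).aestronglyMeasurable
    · refine Eventually.of_forall fun x => ?_
      rw [Real.norm_of_nonneg (hf1 _).1]; exact (hf1 _).2
    · exact (hfc x).comp continuous_inv
  set A : Set Y := {y | ∀ᵐ g ∂(rightHaar G), F (g, y) ≤ b} with hA
  have hAm : MeasurableSet A := by
    have h1 : MeasurableSet {p : Y × G | ¬ F (p.2, p.1) ≤ b} :=
      (measurableSet_le (hFm.comp measurable_swap) measurable_const).compl
    exact measurable_measure_prodMk_left (ν := rightHaar G) h1 (measurableSet_singleton 0)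
  have hgm : MeasurableSet {p : Y × G | p.2⁻¹ • p.1 ∈ A → I p.1 p.2 ≤ b} := by
    have : {p : Y × G | p.2⁻¹ • p.1 ∈ A → I p.1 p.2 ≤ b}
        = {p : Y × G | p.2⁻¹ • p.1 ∈ A}ᶜ ∪ {p : Y × G | I p.1 p.2 ≤ b} := by
      ext p; simp [imp_iff_not_or]
    rw [this]
    exact (hAm.preimage (measurable_snd.inv.smul measurable_fst)).compl.union
      (measurableSet_le hIm measurable_const)
  set S : Set Y := {y | ∀ᵐ g ∂(rightHaar G), g⁻¹ • y ∈ A → I y g ≤ b} with hS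
  have hSm : MeasurableSet S :=
    measurable_measure_prodMk_left (ν := rightHaar G) hgm.compl (measurableSet_singleton 0)
  have hS0 : ∀ᵐ y ∂η, y ∈ S := by
    have h1 : ∀ᵐ g ∂(rightHaar G), ∀ᵐ y ∂η, y ∈ A → F (g, y) ≤ b := by
      refine (Measure.ae_ae_comm (p := fun y g => y ∈ A → F (g, y) ≤ b) ?_).1
        (Eventually.of_forall fun y => ?_)
      · have : {p : Y × G | p.1 ∈ A → F (p.2, p.1) ≤ b}
            = {p : Y × G | p.1 ∈ A}ᶜ ∪ {p : Y × G | F (p.2, p.1) ≤ b} := by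
          ext p; simp [imp_iff_not_or]
        rw [this]
        exact (hAm.preimage measurable_fst).compl.union
          (measurableSet_le (hFm.comp measurable_swap) measurable_const)
      · by_cases hy : y ∈ A
        · filter_upwards [show ∀ᵐ g ∂(rightHaar G), F (g, y) ≤ b from hy] with g hg _ using hg
        · exact Eventually.of_forall fun g h => absurd h hy
    refine (Measure.ae_ae_comm (p := fun y g => g⁻¹ • y ∈ A → I y g ≤ b) hgm).2 ?_
    filter_upwards [h1] with g hg
    filter_upwards [ae_smul hη hg g⁻¹] with y hy h
    rw [hIF]; exact hy h
  refine ⟨Kernel.piecewise hSm D (averageKernel G D), inferInstance, ?_, ?_⟩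
  · filter_upwards [hS0] with y hy
    rw [Kernel.piecewise_apply, if_pos hy]
  filter_upwards [ae_measure_return_ne_zero hη hAm] with y hret hy g
  rw [integral_conjDisintegration _ hf, Kernel.piecewise_apply]
  split_ifs with hgS
  · by_contra hlt
    have hU : {u : G | b < I (g • y) (g * u⁻¹)} ∈ 𝓝 (1 : G) := by
      have hc : Continuous fun u : G => I (g • y) (g * u⁻¹) :=
        (hIc (g • y)).comp (continuous_const.mul continuous_inv)
      refine (isOpen_lt continuous_const hc).mem_nhds ?_
      simpa using not_le.1 hlt
    refine hret hy _ hU ?_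
    have h2 := ae_rightHaar_inv (ae_rightHaar_mul_left
      (show ∀ᵐ k ∂(rightHaar G), k⁻¹ • g • y ∈ A → I (g • y) k ≤ b from hgS) g)
    refine measure_mono_null (fun u hu => ?_) (ae_iff.1 h2)
    intro hc
    have h3 : (g * u⁻¹)⁻¹ • g • y = u • y := by simp [smul_smul]
    rw [h3] at hc
    exact not_le.2 hu.1 (hc hu.2)
  · have hfg : Measurable fun x => f (g⁻¹ • x) := hf.comp (measurable_const_smul g⁻¹)
    rw [integral_averageKernel (G := G) D hfg fun x => hf1 _]
    have h4 : ∀ᵐ h ∂(haarProb G), ∫ x, f (g⁻¹ • x) ∂(conjDisintegration D h (g • y)) ≤ b := by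
      rw [ae_haarProb]
      filter_upwards [ae_rightHaar_mul_right hy g] with h hh
      rw [integral_conjDisintegration D hfg]
      simpa [integral_conjDisintegration D hf, smul_smul, hF] using hh
    refine (integral_mono_ae ?_ (integrable_const b) h4).trans_eq (by simp)
    refine Integrable.of_mem_Icc 0 1 ?_ (Eventually.of_forall fun h => ⟨?_, ?_⟩)
    · exact ((measurable_integral_conjDisintegration D hfg).comp
        (measurable_id.prodMk measurable_const)).aemeasurable
    · exact integral_nonneg fun x => (hf1 _).1
    · refine (integral_mono (Integrable.of_mem_Icc 0 1 hfg.aemeasurable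
        (Eventually.of_forall fun x => hf1 _)) (integrable_const 1) fun x => (hf1 _).2).trans_eq
        (by simp)

end Versions

/-! ### Essential contraction of functions -/

section EssContraction

variable {G : Type*} [Group G] [TopologicalSpace G] [IsTopologicalGroup G] [T2Space G]
  [LocallyCompactSpace G] [SecondCountableTopology G] [MeasurableSpace G] [BorelSpace G]
  {X : Type*} [MeasurableSpace X] [MulAction G X] [MeasurableSMul₂ G X]
  {Y : Type*} [MeasurableSpace Y] [MulAction G Y] [MeasurableSMul₂ G Y]

variable (G) in
/-- For almost every `y`, the essential supremum over `g` of the means of `f` with respect to the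
conjugates `g⁻¹ D(g y)` is at least the essential supremum of `f` with respect to `D y`. Using the
essential supremum over `g` makes the condition independent of the version `D`. -/
def EssContracts (η : Measure Y) (D : Kernel Y X) (f : X → ℝ) : Prop :=
  ∀ b : ℝ, ∀ᵐ y ∂η, (∀ᵐ g ∂(rightHaar G), ∫ x, f x ∂(conjDisintegration D g y) ≤ b) →
    ∀ᵐ x ∂(D y), f x ≤ b

theorem integral_conjDisintegration_mem_Icc (D : Kernel Y X) [IsMarkovKernel D] {f : X → ℝ}
    (hf : Measurable f) (hf1 : ∀ x, f x ∈ Set.Icc (0 : ℝ) 1) (g : G) (y : Y) :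
    ∫ x, f x ∂(conjDisintegration D g y) ∈ Set.Icc (0 : ℝ) 1 :=
  ⟨integral_nonneg fun x => (hf1 x).1, (integral_mono (Integrable.of_mem_Icc 0 1 hf.aemeasurable
    (Eventually.of_forall hf1)) (integrable_const 1) fun x => (hf1 x).2).trans_eq (by simp)⟩

theorem measurableSet_ae_integral_conjDisintegration_le (D : Kernel Y X) [IsMarkovKernel D]
    {f : X → ℝ} (hf : Measurable f) (b : ℝ) :
    MeasurableSet {y | ∀ᵐ g ∂(rightHaar G), ∫ x, f x ∂(conjDisintegration D g y) ≤ b} := by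
  have h1 : MeasurableSet {p : Y × G | ¬ ∫ x, f x ∂(conjDisintegration D p.2 p.1) ≤ b} :=
    (measurableSet_le ((measurable_integral_conjDisintegration D hf).comp measurable_swap)
      measurable_const).compl
  exact measurable_measure_prodMk_left (ν := rightHaar G) h1 (measurableSet_singleton 0)

theorem integral_orbitAverage_conjDisintegration (D : Kernel Y X) [IsMarkovKernel D] {ρ : G → ℝ}
    (hρ : IsBump ρ) {φ : X → ℝ} (hφ : Measurable φ) (hφ1 : ∀ x, φ x ∈ Set.Icc (0 : ℝ) 1)
    (g : G) (y : Y) :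
    ∫ x, orbitAverage ρ φ x ∂(conjDisintegration D g y)
      = ∫ h, ρ h * ∫ x, φ x ∂(conjDisintegration D (g * h⁻¹) (h • y)) ∂(rightHaar G) := by
  have hm : Measurable fun p : X × G => φ (p.2 • p.1) :=
    hφ.comp (measurable_snd.smul measurable_fst)
  have hi : Integrable (Function.uncurry fun (x : X) (h : G) => ρ h * φ (h • x))
      ((conjDisintegration D g y).prod (rightHaar G)) :=
    integrable_mul_of_mem_Icc (hρ.integrable.comp_snd _) hm fun p => hφ1 _
  unfold orbitAverage
  rw [integral_integral_swap hi]
  refine integral_congr_ae (Eventually.of_forall fun h => ?_)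
  simp only [integral_const_mul]
  rw [integral_conjDisintegration D hφ,
    integral_conjDisintegration D (f := fun x => φ (h • x)) (hφ.comp (measurable_const_smul h))]
  simp [smul_smul]

/-- Averages along orbits suffice to test essential contraction. If the means of `φ` are at most
`b` at the points of `A`, then those of `orbitAverage ρ φ` are nearly at most `b` at a point whose
orbit stays in `A` for most of the mass of `ρ`. -/
theorem essContracts_of_orbitAverage {ν : Measure X} [IsProbabilityMeasure ν] {η : Measure Y}
    [IsProbabilityMeasure η]
    (hν : ∀ g : G, Measure.QuasiMeasurePreserving (fun x : X => g • x) ν ν)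
    (hη : ∀ g : G, Measure.QuasiMeasurePreserving (fun y : Y => g • y) η η)
    (D : Kernel Y X) [IsMarkovKernel D] (hD : η.bind D = ν) {φ : X → ℝ} (hφ : Measurable φ)
    (hφ1 : ∀ x, φ x ∈ Set.Icc (0 : ℝ) 1)
    (h : ∀ ρ : G → ℝ, IsBump ρ → EssContracts G η D (orbitAverage ρ φ)) :
    EssContracts G η D φ := by
  intro b
  set A : Set Y := {y | ∀ᵐ g ∂(rightHaar G), ∫ x, φ x ∂(conjDisintegration D g y) ≤ b} with hA
  have hAm : MeasurableSet A := measurableSet_ae_integral_conjDisintegration_le D hφ b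
  set χ : Y → ℝ := A.indicator fun _ => (1 : ℝ)
  have hχ : Measurable χ := measurable_const.indicator hAm
  have hχ1 : ∀ y, χ y ∈ Set.Icc (0 : ℝ) 1 := fun y => by
    by_cases hy : y ∈ A <;> simp [χ, hy]
  obtain ⟨V, hV, hVρ⟩ := exists_nhds_tendsto_orbitAverage hν hφ hφ1
  obtain ⟨W, hW, hWρ⟩ := exists_nhds_tendsto_orbitAverage hη hχ hχ1
  choose ρ hρ hρ0 using fun n => exists_isBump (inter_mem (hV n) (hW n))
  have h1 := hVρ ρ hρ fun n h hh => hρ0 n h fun hi => hh hi.1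
  rw [← hD] at h1
  filter_upwards [hWρ ρ hρ fun n h hh => hρ0 n h fun hi => hh hi.2,
    Measure.ae_ae_of_ae_bind D.measurable.aemeasurable h1,
    ae_all_iff.2 fun n => ae_all_iff.2 fun q : ℚ => h (ρ n) (hρ n) q] with y hy1 hy2 hy3 hyA
  have hyA' : y ∈ A := hyA
  have hb : 0 ≤ b := by
    obtain ⟨g, hg⟩ := hyA.exists
    exact (integral_conjDisintegration_mem_Icc D hφ hφ1 g y).1.trans hg
  have hbound : ∀ n, ∀ᵐ g ∂(rightHaar G), ∫ x, orbitAverage (ρ n) φ x ∂(conjDisintegration D g y)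
      ≤ b + (1 - orbitAverage (ρ n) χ y) := by
    intro n
    set F : G → G → ℝ := fun g h => ∫ x, φ x ∂(conjDisintegration D (g * h⁻¹) (h • y)) with hF
    have hFm : Measurable fun p : G × G => F p.2 p.1 :=
      (measurable_integral_conjDisintegration D hφ).comp
        ((measurable_snd.mul measurable_fst.inv).prodMk (measurable_fst.smul measurable_const))
    have hF1 : ∀ g h, F g h ∈ Set.Icc (0 : ℝ) 1 := fun g h =>
      integral_conjDisintegration_mem_Icc D hφ hφ1 _ _
    have hms : MeasurableSet {p : G × G | p.1 • y ∈ A → F p.2 p.1 ≤ b} := by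
      have : {p : G × G | p.1 • y ∈ A → F p.2 p.1 ≤ b}
          = {p : G × G | p.1 • y ∈ A}ᶜ ∪ {p : G × G | F p.2 p.1 ≤ b} := by
        ext p; simp [imp_iff_not_or]
      rw [this]
      exact (hAm.preimage (measurable_fst.smul measurable_const)).compl.union
        (measurableSet_le hFm measurable_const)
    have h4 : ∀ᵐ g ∂(rightHaar G), ∀ᵐ h ∂(rightHaar G), h • y ∈ A → F g h ≤ b := by
      refine (Measure.ae_ae_comm (p := fun h g => h • y ∈ A → F g h ≤ b) hms).1
        (Eventually.of_forall fun h => ?_)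
      by_cases hh : h • y ∈ A
      · filter_upwards [ae_rightHaar_mul_right
          (show ∀ᵐ g ∂(rightHaar G), ∫ x, φ x ∂(conjDisintegration D g (h • y)) ≤ b from hh) h⁻¹]
          with g hg _ using hg
      · exact Eventually.of_forall fun g hc => absurd hc hh
    filter_upwards [h4] with g hg
    rw [integral_orbitAverage_conjDisintegration D (hρ n) hφ hφ1]
    have hi1 : Integrable (fun h => ρ n h * F g h) (rightHaar G) :=
      integrable_mul_of_mem_Icc (hρ n).integrable
        (hFm.comp (measurable_id.prodMk measurable_const)) fun h => hF1 g h
    have hi2 : Integrable (fun h => ρ n h * χ (h • y)) (rightHaar G) :=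
      (hρ n).integrable_mul hχ hχ1 y
    have hi4 : Integrable (fun h => ρ n h - ρ n h * χ (h • y)) (rightHaar G) :=
      (hρ n).integrable.sub hi2
    have hi3 : Integrable (fun h => ρ n h * b + (ρ n h - ρ n h * χ (h • y))) (rightHaar G) :=
      ((hρ n).integrable.mul_const b).add hi4
    have he : ∫ h, (ρ n h * b + (ρ n h - ρ n h * χ (h • y))) ∂(rightHaar G)
        = b + (1 - orbitAverage (ρ n) χ y) := by
      rw [integral_add ((hρ n).integrable.mul_const b) hi4,
        integral_sub (hρ n).integrable hi2, integral_mul_const, (hρ n).integral_eq_one, one_mul]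
      rfl
    rw [← he]
    refine integral_mono_ae hi1 hi3 ?_
    filter_upwards [hg] with h hh
    have hr := (hρ n).nonneg h
    by_cases hhA : h • y ∈ A
    · simp only [χ, Set.indicator_of_mem hhA, mul_one, sub_self, add_zero]
      exact mul_le_mul_of_nonneg_left (hh hhA) hr
    · simp only [χ, Set.indicator_of_notMem hhA, mul_zero, sub_zero]
      exact (mul_le_of_le_one_right hr (hF1 g h).2).trans (le_add_of_nonneg_left (mul_nonneg hr hb))
  have hχy : χ y = 1 := Set.indicator_of_mem hyA' _
  rw [hχy] at hy1
  have hlim : Tendsto (fun n => b + (1 - orbitAverage (ρ n) χ y)) atTop (𝓝 b) := by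
    simpa using (hy1.const_sub 1).const_add b
  have hq : ∀ᵐ x ∂(D y), ∀ q : ℚ, b < q → φ x ≤ q := by
    refine ae_all_iff.2 fun q => ?_
    by_cases hbq : b < q
    · obtain ⟨N, hN⟩ := eventually_atTop.1 (hlim.eventually_lt_const hbq)
      have h5 : ∀ᵐ x ∂(D y), ∀ n, N ≤ n → orbitAverage (ρ n) φ x ≤ q := by
        refine ae_all_iff.2 fun n => ?_
        by_cases hn : N ≤ n
        · filter_upwards [hy3 n q (by
            filter_upwards [hbound n] with g hg using hg.trans (hN n hn).le)] with x hx _ using hx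
        · exact Eventually.of_forall fun x hc => absurd hc hn
      filter_upwards [h5, hy2] with x hx hx2 _
      exact le_of_tendsto hx2 (eventually_atTop.2 ⟨N, hx⟩)
    · exact Eventually.of_forall fun x hc => absurd hc hbq
  filter_upwards [hq] with x hx
  refine le_of_forall_gt_imp_ge_of_dense fun c hc => ?_
  obtain ⟨q, hq1, hq2⟩ := exists_rat_btwn hc
  exact (hx q hq1).trans hq2.le

end EssContraction

/-! ### Limits along decreasing sequences of convex sets -/

section Convex

/-- A bounded decreasing sequence of nonempty midpoint-convex sets in a Hilbert space has a
convergent sequence of members, namely almost minimisers of the norm. -/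
theorem exists_seq_tendsto_of_antitone_of_midpoint {H : Type*} [NormedAddCommGroup H]
    [InnerProductSpace ℝ H] [CompleteSpace H] {K : ℕ → Set H} (hK : Antitone K)
    (hne : ∀ n, (K n).Nonempty) {R : ℝ} (hR : ∀ x ∈ K 0, ‖x‖ ≤ R)
    (hmid : ∀ n, ∀ x ∈ K n, ∀ y ∈ K n, (2⁻¹ : ℝ) • (x + y) ∈ K n) :
    ∃ v : ℕ → H, (∀ n, v n ∈ K n) ∧ ∃ x, Tendsto v atTop (𝓝 x) := by
  set q : ℕ → ℝ := fun n => sInf ((fun x => ‖x‖ ^ 2) '' K n) with hq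
  have hbdd : ∀ n, BddBelow ((fun x : H => ‖x‖ ^ 2) '' K n) := fun n =>
    ⟨0, by rintro _ ⟨x, -, rfl⟩; positivity⟩
  have hqle : ∀ n, ∀ x ∈ K n, q n ≤ ‖x‖ ^ 2 := fun n x hx => csInf_le (hbdd n) ⟨x, hx, rfl⟩
  have hqmono : Monotone q := fun m n hmn =>
    csInf_le_csInf (hbdd m) ((hne n).image _) (Set.image_mono (hK hmn))
  have hqR : ∀ n, q n ≤ R ^ 2 := by
    intro n
    obtain ⟨x, hx⟩ := hne n
    exact (hqle n x hx).trans (pow_le_pow_left₀ (norm_nonneg x) (hR x (hK (Nat.zero_le n) hx)) 2)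
  have hbq : BddAbove (Set.range q) := ⟨R ^ 2, by rintro _ ⟨n, rfl⟩; exact hqR n⟩
  set L : ℝ := ⨆ n, q n
  have hqL : Tendsto q atTop (𝓝 L) := tendsto_atTop_ciSup hqmono hbq
  have hex : ∀ n : ℕ, ∃ x ∈ K n, ‖x‖ ^ 2 < q n + 1 / ((n : ℝ) + 1) := by
    intro n
    obtain ⟨_, ⟨x, hx, rfl⟩, hlt⟩ := exists_lt_of_csInf_lt ((hne n).image fun x => ‖x‖ ^ 2)
      (lt_add_of_pos_right (q n) (Nat.one_div_pos_of_nat (α := ℝ) (n := n)))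
    exact ⟨x, hx, hlt⟩
  choose v hv hvlt using hex
  refine ⟨v, hv, cauchySeq_tendsto_of_complete ?_⟩
  refine cauchySeq_of_le_tendsto_0 (fun N => √(4 * (L - q N) + 4 * (1 / ((N : ℝ) + 1))))
    (fun n m N hn hm => ?_) ?_
  · rw [dist_eq_norm]
    refine Real.le_sqrt_of_sq_le ?_
    have h1 := parallelogram_law_with_norm ℝ (v n) (v m)
    have h2 := hqle N _ (hmid N _ (hK hn (hv n)) _ (hK hm (hv m)))
    rw [norm_smul, mul_pow, Real.norm_of_nonneg (by norm_num)] at h2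
    have h3 : ∀ k, N ≤ k → ‖v k‖ ^ 2 ≤ L + 1 / ((N : ℝ) + 1) := fun k hk =>
      (hvlt k).le.trans (add_le_add (le_ciSup hbq k) (Nat.one_div_le_one_div hk))
    have := h3 n hn
    have := h3 m hm
    linarith
  · have h4 := ((hqL.const_sub L).const_mul 4).add
      (tendsto_one_div_add_atTop_nhds_zero_nat (𝕜 := ℝ) |>.const_mul 4)
    simpa using h4.sqrt

/-- A decreasing sequence of nonempty midpoint-convex sets of functions with values in `[0, 1]` has
a sequence of members that converges almost everywhere. -/
theorem exists_seq_ae_tendsto_of_antitone_of_midpoint {X : Type*} [MeasurableSpace X]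
    {ν : Measure X} [IsFiniteMeasure ν] {C : ℕ → Set (X → ℝ)} (hC : Antitone C)
    (hne : ∀ n, (C n).Nonempty) (hm : ∀ n, ∀ φ ∈ C n, Measurable φ)
    (h01 : ∀ n, ∀ φ ∈ C n, ∀ x, φ x ∈ Set.Icc (0 : ℝ) 1)
    (hmid : ∀ n, ∀ φ ∈ C n, ∀ ψ ∈ C n, (fun x => 2⁻¹ * (φ x + ψ x)) ∈ C n) :
    ∃ φ : X → ℝ, Measurable φ ∧ (∀ x, φ x ∈ Set.Icc (0 : ℝ) 1) ∧ ∃ v : ℕ → X → ℝ,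
      (∀ n, v n ∈ C n) ∧ ∀ᵐ x ∂ν, Tendsto (fun n => v n x) atTop (𝓝 (φ x)) := by
  have hLp : ∀ n, ∀ φ ∈ C n, MemLp φ 2 ν := fun n φ hφ =>
    MemLp.of_bound (hm n φ hφ).aestronglyMeasurable 1 (Eventually.of_forall fun x => by
      rw [Real.norm_of_nonneg (h01 n φ hφ x).1]; exact (h01 n φ hφ x).2)
  set K : ℕ → Set (Lp ℝ 2 ν) := fun n => {F | ∃ φ ∈ C n, F =ᵐ[ν] φ} with hK
  obtain ⟨V, hV, F, hF⟩ := exists_seq_tendsto_of_antitone_of_midpoint (K := K)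
    (R := (measureUnivNNReal ν : ℝ) ^ (2 : ENNReal).toReal⁻¹ * 1)
    (fun m n hmn F ⟨φ, hφ, h⟩ => ⟨φ, hC hmn hφ, h⟩)
    (fun n => by
      obtain ⟨φ, hφ⟩ := hne n
      exact ⟨(hLp n φ hφ).toLp φ, φ, hφ, MemLp.coeFn_toLp _⟩)
    (fun F ⟨φ, hφ, h⟩ => by
      refine Lp.norm_le_of_ae_bound zero_le_one ?_
      filter_upwards [h] with x hx
      rw [hx, Real.norm_of_nonneg (h01 0 φ hφ x).1]; exact (h01 0 φ hφ x).2)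
    (fun n F ⟨φ, hφ, h⟩ F' ⟨φ', hφ', h'⟩ => by
      refine ⟨_, hmid n φ hφ φ' hφ', ?_⟩
      filter_upwards [h, h', Lp.coeFn_smul (2⁻¹ : ℝ) (F + F'), Lp.coeFn_add F F']
        with x h1 h2 h3 h4
      rw [h3, Pi.smul_apply, h4, Pi.add_apply, h1, h2, smul_eq_mul])
  choose w hw hVw using hV
  obtain ⟨ns, hns, hlim⟩ := (tendstoInMeasure_of_tendsto_Lp hF).exists_seq_tendsto_ae
  have hFm : Measurable F := (Lp.stronglyMeasurable F).measurable
  refine ⟨fun x => max 0 (min 1 (F x)), measurable_const.max (measurable_const.min hFm),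
    fun x => ⟨le_max_left _ _, max_le zero_le_one (min_le_left _ _)⟩, fun n => w (ns n),
    fun n => hC (hns.id_le n) (hw (ns n)), ?_⟩
  filter_upwards [hlim, ae_all_iff.2 hVw] with x hx hx2
  simp_rw [hx2] at hx
  have h0 : 0 ≤ F x := ge_of_tendsto' hx fun n => (h01 _ _ (hw (ns n)) x).1
  have h1 : F x ≤ 1 := le_of_tendsto' hx fun n => (h01 _ _ (hw (ns n)) x).2
  rw [min_eq_right h1, max_eq_right h0]
  exact hx

/-- A countably generated measurable space has a sequence of measurable sets that is dense for
every finite measure. -/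
theorem exists_seq_measurableSet_dense (X : Type*) [mX : MeasurableSpace X]
    [MeasurableSpace.CountablyGenerated X] :
    ∃ A : ℕ → Set X, (∀ i, MeasurableSet (A i)) ∧ ∀ (μ : Measure X) [IsFiniteMeasure μ] (B : Set X),
      MeasurableSet B → ∀ ε > 0, ∃ i, μ.real (symmDiff B (A i)) < ε := by
  set 𝒜 := generateSetAlgebra (MeasurableSpace.countableGeneratingSet X)
  have hgen : mX = MeasurableSpace.generateFrom 𝒜 := by
    rw [generateFrom_generateSetAlgebra_eq, MeasurableSpace.generateFrom_countableGeneratingSet]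
  have hd : ∀ (μ : Measure X) [IsFiniteMeasure μ], μ.MeasureDense 𝒜 := fun μ _ =>
    Measure.MeasureDense.of_generateFrom_isSetAlgebra_finite μ isSetAlgebra_generateSetAlgebra hgen
  obtain ⟨A, hA⟩ := (countable_generateSetAlgebra
    (MeasurableSpace.countable_countableGeneratingSet (α := X))).exists_eq_range (hd 0).nonempty
  refine ⟨A, fun i => (hd 0).measurable _ (by
    rw [show 𝒜 = Set.range A from hA]; exact Set.mem_range_self i), fun μ _ B hB ε hε => ?_⟩
  obtain ⟨t, ht, hlt⟩ := (hd μ).approx B hB (measure_ne_top μ B) ε hε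
  obtain ⟨i, rfl⟩ : t ∈ Set.range A := by
    rw [← hA]; exact ht
  exact ⟨i, by rw [Measure.real]; exact ENNReal.toReal_lt_of_lt_ofReal hlt⟩

end Convex

/-! ### From functions on the whole space to sets depending on the fibre -/

section Selection

variable {G : Type*} [Group G] [TopologicalSpace G] [IsTopologicalGroup G] [T2Space G]
  [LocallyCompactSpace G] [SecondCountableTopology G] [MeasurableSpace G] [BorelSpace G]
  {X : Type*} [MeasurableSpace X] [MulAction G X] [MeasurableSMul₂ G X]
  {Y : Type*} [MeasurableSpace Y] [MulAction G Y] [MeasurableSMul₂ G Y]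

/-- Almost every conjugate `g⁻¹ D(g y)` lives on the fibre over `y`. -/
theorem ae_ae_ae_conjDisintegration_eq [MeasurableEq Y] {ν : Measure X} {η : Measure Y}
    [SFinite η] (hη : ∀ g : G, Measure.QuasiMeasurePreserving (fun y : Y => g • y) η η)
    {D : Kernel Y X} [IsMarkovKernel D] (hD : η.bind D = ν) {π : X → Y} (hπ : IsGMap G ν η π)
    (hc : ∀ᵐ y ∂η, ∀ᵐ x ∂(D y), π x = y) :
    ∀ᵐ y ∂η, ∀ᵐ g ∂(rightHaar G), ∀ᵐ x ∂(conjDisintegration D g y), π x = y := by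
  have hm : Measurable fun q : G × X => q.1⁻¹ • q.2 := measurable_fst.inv.smul measurable_snd
  have hms : MeasurableSet {q : G × X | π (q.1⁻¹ • q.2) = q.1⁻¹ • π q.2} :=
    measurableSet_eq_fun (hπ.measurable.comp hm)
      (measurable_fst.inv.smul (hπ.measurable.comp measurable_snd))
  filter_upwards [ae_ae_ae_fibre (p := fun (g : G) x => π (g⁻¹ • x) = g⁻¹ • π x) hη hD hms
    fun g => hπ.equivariant g⁻¹, ae_ae_smul hη hc] with y h1 h2
  filter_upwards [h1, h2] with g h3 h4
  have hms2 : MeasurableSet {x | π x = y} := measurableSet_eq_fun hπ.measurable measurable_const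
  refine (ae_map_iff (measurable_const_smul g⁻¹).aemeasurable hms2).2 ?_
  filter_upwards [h3, h4] with x h5 h6
  rw [h5, h6, inv_smul_smul]

/-- The mean excess over `s` of the means of `φ` with respect to the conjugates `g⁻¹ D(g y)`.
It is convex in `φ`, and vanishes exactly if almost all these means are at most `s`. -/
noncomputable def excess (G : Type*) [Group G] [TopologicalSpace G] [IsTopologicalGroup G]
    [LocallyCompactSpace G] [SecondCountableTopology G] [MeasurableSpace G] [BorelSpace G]
    [MulAction G X] [MulAction G Y] (D : Kernel Y X) (s : ℝ) (φ : X → ℝ) (y : Y) : ℝ :=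
  ∫ g : G, max (∫ x, φ x ∂(conjDisintegration D g y) - s) 0 ∂(haarProb G)

theorem measurable_excess (D : Kernel Y X) [IsMarkovKernel D] (s : ℝ) {φ : X → ℝ}
    (hφ : Measurable φ) : Measurable (excess G D s φ) := by
  have : Measurable fun p : Y × G => max (∫ x, φ x ∂(conjDisintegration D p.2 p.1) - s) 0 :=
    (((measurable_integral_conjDisintegration D hφ).comp measurable_swap).sub_const s).max
      measurable_const
  exact (this.stronglyMeasurable.integral_prod_right (ν := haarProb G)).measurable

theorem integrable_max_sub (D : Kernel Y X) [IsMarkovKernel D] (s : ℝ) {φ : X → ℝ}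
    (hφ : Measurable φ) (hφ1 : ∀ x, φ x ∈ Set.Icc (0 : ℝ) 1) (y : Y) :
    Integrable (fun g : G => max (∫ x, φ x ∂(conjDisintegration D g y) - s) 0) (haarProb G) := by
  have : Integrable (fun g : G => ∫ x, φ x ∂(conjDisintegration D g y)) (haarProb G) :=
    Integrable.of_mem_Icc 0 1 ((measurable_integral_conjDisintegration D hφ).comp
      (measurable_id.prodMk measurable_const)).aemeasurable
      (Eventually.of_forall fun g => integral_conjDisintegration_mem_Icc D hφ hφ1 g y)
  exact (this.sub (integrable_const s)).pos_part

theorem excess_midpoint_le (D : Kernel Y X) [IsMarkovKernel D] (s : ℝ) {φ ψ : X → ℝ}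
    (hφ : Measurable φ) (hφ1 : ∀ x, φ x ∈ Set.Icc (0 : ℝ) 1)
    (hψ : Measurable ψ) (hψ1 : ∀ x, ψ x ∈ Set.Icc (0 : ℝ) 1) (y : Y) :
    excess G D s (fun x => 2⁻¹ * (φ x + ψ x)) y ≤ 2⁻¹ * (excess G D s φ y + excess G D s ψ y) := by
  have hm : Measurable fun x => 2⁻¹ * (φ x + ψ x) := (hφ.add hψ).const_mul _
  have hm1 : ∀ x, 2⁻¹ * (φ x + ψ x) ∈ Set.Icc (0 : ℝ) 1 := fun x => by
    have h1 := hφ1 x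
    have h2 := hψ1 x
    constructor <;> linarith [h1.1, h1.2, h2.1, h2.2]
  have hi1 := integrable_max_sub (G := G) D s hφ hφ1 y
  have hi2 := integrable_max_sub (G := G) D s hψ hψ1 y
  unfold excess
  rw [← integral_add hi1 hi2, ← integral_const_mul]
  refine integral_mono (integrable_max_sub D s hm hm1 y) ((hi1.add hi2).const_mul _) fun g => ?_
  simp only
  rw [integral_const_mul, integral_add
    (Integrable.of_mem_Icc 0 1 hφ.aemeasurable (Eventually.of_forall hφ1))
    (Integrable.of_mem_Icc 0 1 hψ.aemeasurable (Eventually.of_forall hψ1))]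
  set a := ∫ x, φ x ∂(conjDisintegration D g y)
  set c := ∫ x, ψ x ∂(conjDisintegration D g y)
  refine max_le ?_ ?_
  · linarith [le_max_left (a - s) 0, le_max_left (c - s) 0]
  · linarith [le_max_right (a - s) 0, le_max_right (c - s) 0]

theorem excess_congr (D : Kernel Y X) (s : ℝ) {φ ψ : X → ℝ} {y : Y}
    (h : ∀ᵐ g ∂(rightHaar G), φ =ᵐ[conjDisintegration D g y] ψ) :
    excess G D s φ y = excess G D s ψ y := by
  refine integral_congr_ae ?_
  rw [EventuallyEq, ae_haarProb]
  filter_upwards [h] with g hg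
  rw [integral_congr_ae hg]

theorem tendsto_excess (D : Kernel Y X) [IsMarkovKernel D] (s : ℝ) {φ : X → ℝ} {v : ℕ → X → ℝ}
    (hv : ∀ n, Measurable (v n)) (hv1 : ∀ n x, v n x ∈ Set.Icc (0 : ℝ) 1) {y : Y}
    (h : ∀ᵐ g ∂(rightHaar G), ∀ᵐ x ∂(conjDisintegration D g y),
      Tendsto (fun n => v n x) atTop (𝓝 (φ x))) :
    Tendsto (fun n => excess G D s (v n) y) atTop (𝓝 (excess G D s φ y)) := by
  refine tendsto_integral_of_dominated_convergence (fun _ => |1 - s| + |s|)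
    (fun n => (integrable_max_sub D s (hv n) (hv1 n) y).aestronglyMeasurable)
    (integrable_const _) (fun n => Eventually.of_forall fun g => ?_) ?_
  · have := integral_conjDisintegration_mem_Icc D (hv n) (hv1 n) g y
    rw [Real.norm_of_nonneg (le_max_right _ _)]
    refine max_le ?_ (by positivity)
    linarith [this.2, le_abs_self (1 - s), abs_nonneg s]
  · rw [ae_haarProb]
    filter_upwards [h] with g hg
    refine ((Tendsto.sub_const ?_ s)).max tendsto_const_nhds
    refine tendsto_integral_of_dominated_convergence (fun _ => 1)
      (fun n => (hv n).aestronglyMeasurable) (integrable_const _)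
      (fun n => Eventually.of_forall fun x => ?_) hg
    rw [Real.norm_of_nonneg (hv1 n x).1]; exact (hv1 n x).2

/-- A measurable selection: suppose that each point of a measurable set `S` has, for every `n`, a
measurable set `A i` with excess at most `1 / (n + 1)` whose trace on `E` is nearly as large as
prescribed by `t`. Then some function on the whole space does so exactly, at almost every point
of `S`. The sets may be chosen measurably as the index is a natural number, and the constraints
are convex, so the choices for varying `n` may be replaced by an almost everywhere convergent
sequence. -/
theorem exists_measurable_selection [MeasurableEq Y] {ν : Measure X} [IsProbabilityMeasure ν]
    {η : Measure Y} [IsProbabilityMeasure η]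
    (hν : ∀ g : G, Measure.QuasiMeasurePreserving (fun x : X => g • x) ν ν)
    (hη : ∀ g : G, Measure.QuasiMeasurePreserving (fun y : Y => g • y) η η)
    {D : Kernel Y X} [IsMarkovKernel D] (hD : η.bind D = ν) {π : X → Y} (hπ : IsGMap G ν η π)
    (hc : ∀ᵐ y ∂η, ∀ᵐ x ∂(D y), π x = y) {A : ℕ → Set X} (hA : ∀ i, MeasurableSet (A i))
    {E : Set X} (hE : MeasurableSet E) (s t : ℝ) {S : Set Y}
    (hSA : ∀ y ∈ S, ∀ n : ℕ, ∃ i, excess G D s ((A i).indicator 1) y ≤ 1 / ((n : ℝ) + 1) ∧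
      t * (D y).real E - 1 / ((n : ℝ) + 1) ≤ ∫ x in E, (A i).indicator 1 x ∂(D y)) :
    ∃ φ : X → ℝ, Measurable φ ∧ (∀ x, φ x ∈ Set.Icc (0 : ℝ) 1) ∧ ∀ᵐ y ∂η, y ∈ S →
      (∀ᵐ g ∂(rightHaar G), ∫ x, φ x ∂(conjDisintegration D g y) ≤ s) ∧
        t * (D y).real E ≤ ∫ x in E, φ x ∂(D y) := by
  have hAm : ∀ i, Measurable ((A i).indicator (1 : X → ℝ)) := fun i =>
    measurable_one.indicator (hA i)
  set C : ℕ → Set (X → ℝ) := fun n => {φ | Measurable φ ∧ (∀ x, φ x ∈ Set.Icc (0 : ℝ) 1) ∧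
    ∀ᵐ y ∂η, y ∈ S → excess G D s φ y ≤ 1 / ((n : ℝ) + 1) ∧
      t * (D y).real E - 1 / ((n : ℝ) + 1) ≤ ∫ x in E, φ x ∂(D y)} with hCdef
  have hi : ∀ {φ : X → ℝ} (y : Y), Measurable φ → (∀ x, φ x ∈ Set.Icc (0 : ℝ) 1) →
      Integrable φ ((D y).restrict E) := fun y h1 h2 =>
    Integrable.of_mem_Icc 0 1 h1.aemeasurable (Eventually.of_forall h2)
  have hC : Antitone C := by
    rintro m n hmn φ ⟨h1, h2, h3⟩
    refine ⟨h1, h2, ?_⟩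
    have hle : 1 / ((n : ℝ) + 1) ≤ 1 / ((m : ℝ) + 1) := Nat.one_div_le_one_div hmn
    filter_upwards [h3] with y hy hyS
    exact ⟨(hy hyS).1.trans hle, (sub_le_sub_left hle _).trans (hy hyS).2⟩
  have hne : ∀ n, (C n).Nonempty := by
    intro n
    -- `T i` consists of the points at which the index `i` meets the constraints.
    set T : ℕ → Set Y := fun i => {y | excess G D s ((A i).indicator 1) y ≤ 1 / ((n : ℝ) + 1) ∧
      t * (D y).real E - 1 / ((n : ℝ) + 1) ≤ ∫ x in E, (A i).indicator 1 x ∂(D y)} with hT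
    have hTm : ∀ i, MeasurableSet (T i) := by
      intro i
      refine MeasurableSet.inter (s₁ := {y | excess G D s ((A i).indicator 1) y ≤ 1 / ((n : ℝ) + 1)})
        (s₂ := {y | t * (D y).real E - 1 / ((n : ℝ) + 1) ≤ ∫ x in E, (A i).indicator 1 x ∂(D y)})
        (measurableSet_le (measurable_excess D s (hAm i)) measurable_const) (measurableSet_le ?_ ?_)
      · exact ((Kernel.measurable_coe D hE).ennreal_toReal.const_mul t).sub_const _
      · have : ∀ y, ∫ x in E, (A i).indicator (1 : X → ℝ) x ∂(D y) = (D y).real (A i ∩ E) := by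
          intro y
          rw [integral_indicator_one (hA i), measureReal_restrict_apply (hA i)]
        simp_rw [this]
        exact (Kernel.measurable_coe D ((hA i).inter hE)).ennreal_toReal
    set B : Set X := ⋃ i, A i ∩ π ⁻¹' (disjointed T i) with hB
    have hBm : MeasurableSet B := MeasurableSet.iUnion fun i =>
      (hA i).inter (hπ.measurable (MeasurableSet.disjointed hTm i))
    have hBi : ∀ i y x, y ∈ disjointed T i → π x = y →
        B.indicator (1 : X → ℝ) x = (A i).indicator 1 x := by
      intro i y x hy hx
      have : x ∈ B ↔ x ∈ A i := by
        rw [hB, Set.mem_iUnion]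
        refine ⟨fun ⟨j, hj, hjT⟩ => ?_, fun h => ⟨i, h, by rw [Set.mem_preimage, hx]; exact hy⟩⟩
        rw [Set.mem_preimage, hx] at hjT
        by_cases hij : i = j
        · rwa [hij]
        · exact absurd hjT (Set.disjoint_left.1 (disjoint_disjointed T hij) hy)
      by_cases h : x ∈ A i
      · simp [h, this.2 h]
      · rw [Set.indicator_of_notMem h, Set.indicator_of_notMem fun hc => h (this.1 hc)]
    refine ⟨B.indicator 1, measurable_one.indicator hBm, fun x => ?_, ?_⟩
    · by_cases hx : x ∈ B <;> simp [hx]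
    filter_upwards [hc, ae_ae_ae_conjDisintegration_eq hη hD hπ hc] with y hy1 hy2 hyS
    obtain ⟨i, hi⟩ : ∃ i, y ∈ disjointed T i := by
      obtain ⟨i, hi⟩ := hSA y hyS n
      have : y ∈ ⋃ i, T i := Set.mem_iUnion.2 ⟨i, hi⟩
      rw [← iUnion_disjointed] at this
      exact Set.mem_iUnion.1 this
    have hyT : y ∈ T i := disjointed_subset T i hi
    have e1 : excess G D s (B.indicator 1) y = excess G D s ((A i).indicator 1) y := by
      refine excess_congr D s ?_
      filter_upwards [hy2] with g hg
      filter_upwards [hg] with x hx using hBi i y x hi hx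
    have e2 : ∫ x in E, B.indicator (1 : X → ℝ) x ∂(D y)
        = ∫ x in E, (A i).indicator 1 x ∂(D y) := by
      refine integral_congr_ae (ae_restrict_of_ae ?_)
      filter_upwards [hy1] with x hx using hBi i y x hi hx
    rw [e1, e2]
    exact hyT
  obtain ⟨φ, hφ, hφ1, v, hv, hlim⟩ := exists_seq_ae_tendsto_of_antitone_of_midpoint (ν := ν) hC hne
    (fun n φ h => h.1) (fun n φ h => h.2.1) (fun n φ h ψ h' => by
      refine ⟨(h.1.add h'.1).const_mul _, fun x => ?_, ?_⟩
      · have h1 := h.2.1 x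
        have h2 := h'.2.1 x
        constructor <;> linarith [h1.1, h1.2, h2.1, h2.2]
      filter_upwards [h.2.2, h'.2.2] with y h1 h2 hyS
      refine ⟨(excess_midpoint_le D s h.1 h.2.1 h'.1 h'.2.1 y).trans ?_, ?_⟩
      · linarith [(h1 hyS).1, (h2 hyS).1]
      · rw [integral_const_mul, integral_add (hi y h.1 h.2.1) (hi y h'.1 h'.2.1)]
        linarith [(h1 hyS).2, (h2 hyS).2])
  refine ⟨φ, hφ, hφ1, ?_⟩
  have hlimD := hlim
  rw [← hD] at hlimD
  filter_upwards [Measure.ae_ae_of_ae_bind D.measurable.aemeasurable hlimD,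
    ae_ae_ae_conjDisintegration hν hη hD hlim, ae_all_iff.2 fun n => (hv n).2.2]
    with y hy1 hy2 hy3 hyS
  have ht0 := tendsto_one_div_add_atTop_nhds_zero_nat (𝕜 := ℝ)
  constructor
  · have h1 : excess G D s φ y ≤ 0 :=
      le_of_tendsto_of_tendsto' (tendsto_excess D s (fun n => (hv n).1) (fun n => (hv n).2.1) hy2)
        ht0 fun n => (hy3 n hyS).1
    have h2 : excess G D s φ y = 0 :=
      le_antisymm h1 (integral_nonneg fun g => le_max_right _ _)
    have h3 := (integral_eq_zero_iff_of_nonneg (fun g => le_max_right _ _)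
      (integrable_max_sub D s hφ hφ1 y)).1 h2
    rw [EventuallyEq, ae_haarProb] at h3
    filter_upwards [h3] with g hg
    have h4 := (le_max_left _ _).trans_eq hg
    simpa using h4
  · have h4 : Tendsto (fun n => ∫ x in E, v n x ∂(D y)) atTop (𝓝 (∫ x in E, φ x ∂(D y))) := by
      refine tendsto_integral_of_dominated_convergence (fun _ => 1)
        (fun n => (hv n).1.aestronglyMeasurable) (integrable_const _)
        (fun n => Eventually.of_forall fun x => ?_) (ae_restrict_of_ae hy1)
      rw [Real.norm_of_nonneg ((hv n).2.1 x).1]; exact ((hv n).2.1 x).2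
    have h5 := ht0.const_sub (t * (D y).real E)
    rw [sub_zero] at h5
    exact le_of_tendsto_of_tendsto' h5 h4 fun n => (hy3 n hyS).2

/-- Essential contraction of all functions gives relative contractivity. A set `B` for which it
fails may depend on `y`. The function provided by `exists_measurable_selection` combines such sets
for many `y` at a time. -/
theorem ae_iSup_conjDisintegration_eq_one [MeasurableSpace.CountablyGenerated X] [MeasurableEq Y]
    {ν : Measure X} [IsProbabilityMeasure ν] {η : Measure Y} [IsProbabilityMeasure η]
    (hν : ∀ g : G, Measure.QuasiMeasurePreserving (fun x : X => g • x) ν ν)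
    (hη : ∀ g : G, Measure.QuasiMeasurePreserving (fun y : Y => g • y) η η)
    {D : Kernel Y X} [IsMarkovKernel D] (hD : η.bind D = ν) {π : X → Y} (hπ : IsGMap G ν η π)
    (hc : ∀ᵐ y ∂η, ∀ᵐ x ∂(D y), π x = y)
    (h : ∀ φ : X → ℝ, Measurable φ → (∀ x, φ x ∈ Set.Icc (0 : ℝ) 1) → EssContracts G η D φ) :
    ∀ᵐ y ∂η, ∀ B : Set X, MeasurableSet B → 0 < D y B →
      ⨆ g : G, conjDisintegration D g y B = 1 := by
  obtain ⟨A, hA, hAd⟩ := exists_seq_measurableSet_dense X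
  -- The points at which the constraints of the selection can be met arbitrarily well.
  set S : ℚ → ℚ → ℕ → Set Y := fun s t k => {y | ∀ n : ℕ, ∃ i,
    excess G D s ((A i).indicator 1) y ≤ 1 / ((n : ℝ) + 1) ∧
      t * (D y).real (A k) - 1 / ((n : ℝ) + 1) ≤ ∫ x in A k, (A i).indicator 1 x ∂(D y)} with hS
  have hS0 : ∀ s t : ℚ, s < t → ∀ k, ∀ᵐ y ∂η, y ∈ S s t k → (D y).real (A k) = 0 := by
    intro s t hst k
    obtain ⟨φ, hφ, hφ1, hφS⟩ := exists_measurable_selection hν hη hD hπ hc hA (hA k) (s : ℝ) t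
      (S := S s t k) fun y hy => hy
    filter_upwards [hφS, h φ hφ hφ1 s] with y h1 h2 hyS
    have h3 := h2 (h1 hyS).1
    have h4 : ∫ x in A k, φ x ∂(D y) ≤ ∫ x in A k, (s : ℝ) ∂(D y) :=
      integral_mono_ae (Integrable.of_mem_Icc 0 1 hφ.aemeasurable (Eventually.of_forall hφ1))
        (integrable_const _) (ae_restrict_of_ae h3)
    rw [setIntegral_const, smul_eq_mul] at h4
    have h5 := (h1 hyS).2.trans h4
    have h6 : (s : ℝ) < t := by exact_mod_cast hst
    have h7 : 0 ≤ (D y).real (A k) := measureReal_nonneg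
    nlinarith
  filter_upwards [ae_all_iff.2 fun s : ℚ => ae_all_iff.2 fun t : ℚ => ae_all_iff.2 fun k =>
    (show ∀ᵐ y ∂η, s < t → y ∈ S s t k → (D y).real (A k) = 0 by
      by_cases hst : s < t
      · filter_upwards [hS0 s t hst k] with y hy _ using hy
      · exact Eventually.of_forall fun y hc => absurd hc hst)] with y hy B hB hB0
  by_contra hne
  have hlt : ⨆ g : G, conjDisintegration D g y B < 1 :=
    lt_of_le_of_ne (iSup_le fun g => prob_le_one) hne
  obtain ⟨s, hs0, hs1, hs2⟩ := ENNReal.lt_iff_exists_rat_btwn.1 hlt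
  have hs3 : (s : ℝ) < 1 := by
    have : ENNReal.ofReal (s : ℝ) < ENNReal.ofReal 1 := by simpa [ENNReal.ofReal] using hs2
    exact (ENNReal.ofReal_lt_ofReal_iff zero_lt_one).1 this
  obtain ⟨t, hst, ht1⟩ := exists_rat_btwn hs3
  have hsr : (0 : ℝ) ≤ s := by exact_mod_cast hs0
  have ht0 : (0 : ℝ) < t := hsr.trans_lt hst
  have hBs : ∀ g : G, (conjDisintegration D g y).real B ≤ s := by
    intro g
    refine ENNReal.toReal_le_of_le_ofReal hsr ?_
    exact (le_iSup (fun g : G => conjDisintegration D g y B) g).trans hs1.le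
  set β : ℝ := (D y).real B with hβ
  have hβ0 : 0 < β := ENNReal.toReal_pos hB0.ne' (measure_ne_top _ _)
  -- With this precision, `A k` is nonnull and `B` fills at least the proportion `t` of it.
  obtain ⟨k, hk⟩ := hAd (D y) B hB ((1 - t) / (1 + t) * β)
    (mul_pos (div_pos (by linarith) (by linarith)) hβ0)
  set ε : ℝ := (1 - t) / (1 + t) * β with hε
  have hεt : ε * (1 + t) = (1 - t) * β := by
    rw [hε]; field_simp
  have hd1 : β ≤ (D y).real (B ∩ A k) + (D y).real (symmDiff B (A k)) := by
    refine (measureReal_mono ?_).trans (measureReal_union_le _ _)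
    intro x hx
    by_cases hxA : x ∈ A k
    · exact Or.inl ⟨hx, hxA⟩
    · exact Or.inr (Or.inl ⟨hx, hxA⟩)
  have hd2 : (D y).real (A k) ≤ β + (D y).real (symmDiff B (A k)) := by
    refine (measureReal_mono ?_).trans (measureReal_union_le _ _)
    intro x hx
    by_cases hxB : x ∈ B
    · exact Or.inl hxB
    · exact Or.inr (Or.inr ⟨hx, hxB⟩)
  have hd3 : (D y).real (B ∩ A k) ≤ (D y).real (A k) := measureReal_mono Set.inter_subset_right
  have hd4 : t * (D y).real (A k) ≤ (D y).real (B ∩ A k) := by nlinarith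
  have hkpos : (D y).real (A k) ≠ 0 := by
    have : 0 < (D y).real (A k) := by nlinarith
    exact this.ne'
  refine hkpos (hy s t k (by exact_mod_cast hst) fun n => ?_)
  obtain ⟨i, hi⟩ := hAd (D y + averageKernel G D y) B hB (1 / ((n : ℝ) + 1))
    Nat.one_div_pos_of_nat
  rw [measureReal_add_apply] at hi
  have hsd : MeasurableSet (symmDiff B (A i)) := hB.symmDiff (hA i)
  refine ⟨i, ?_, ?_⟩
  · have h1 : excess G D s ((A i).indicator 1) y
        ≤ (averageKernel G D y).real (symmDiff B (A i)) := by
      have hm : Measurable ((symmDiff B (A i)).indicator (1 : X → ℝ)) :=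
        measurable_one.indicator hsd
      have hm1 : ∀ x, (symmDiff B (A i)).indicator (1 : X → ℝ) x ∈ Set.Icc (0 : ℝ) 1 :=
        fun x => by by_cases hx : x ∈ symmDiff B (A i) <;> simp [hx]
      have hA1 : ∀ x, (A i).indicator (1 : X → ℝ) x ∈ Set.Icc (0 : ℝ) 1 :=
        fun x => by by_cases hx : x ∈ A i <;> simp [hx]
      rw [← integral_indicator_one hsd, integral_averageKernel D hm hm1]
      refine integral_mono (integrable_max_sub D s (measurable_one.indicator (hA i)) hA1 y)
        (Integrable.of_mem_Icc 0 1 ((measurable_integral_conjDisintegration D hm).comp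
          (measurable_id.prodMk measurable_const)).aemeasurable
          (Eventually.of_forall fun g => integral_conjDisintegration_mem_Icc D hm hm1 g y))
        fun g => ?_
      simp only [integral_indicator_one hsd, integral_indicator_one (hA i)]
      refine max_le ?_ measureReal_nonneg
      have h2 : (conjDisintegration D g y).real (A i) ≤ (conjDisintegration D g y).real B
          + (conjDisintegration D g y).real (symmDiff B (A i)) := by
        refine (measureReal_mono ?_).trans (measureReal_union_le _ _)
        intro x hx
        by_cases hxB : x ∈ B
        · exact Or.inl hxB
        · exact Or.inr (Or.inr ⟨hx, hxB⟩)
      linarith [hBs g]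
    linarith [measureReal_nonneg (μ := D y) (s := symmDiff B (A i))]
  · rw [integral_indicator_one (hA i), measureReal_restrict_apply (hA i)]
    have h3 : (D y).real (B ∩ A k) ≤ (D y).real (A i ∩ A k)
        + (D y).real (symmDiff B (A i)) := by
      refine (measureReal_mono ?_).trans (measureReal_union_le _ _)
      intro x hx
      by_cases hxA : x ∈ A i
      · exact Or.inl ⟨hxA, hx.2⟩
      · exact Or.inr (Or.inl ⟨hx.1, hxA⟩)
    linarith [measureReal_nonneg (μ := averageKernel G D y) (s := symmDiff B (A i))]

end Selection

/-! ### Essential contraction and isomorphisms -/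

section Transfer

variable {G : Type*} [Group G] [TopologicalSpace G] [IsTopologicalGroup G] [T2Space G]
  [LocallyCompactSpace G] [SecondCountableTopology G] [MeasurableSpace G] [BorelSpace G]
  {X : Type*} [MeasurableSpace X] [MulAction G X] [MeasurableSMul₂ G X]
  {Y : Type*} [MeasurableSpace Y] [MulAction G Y] [MeasurableSMul₂ G Y]
  {X₀ : Type*} [MeasurableSpace X₀] [MulAction G X₀] [MeasurableSMul₂ G X₀]
  {Y₀ : Type*} [MeasurableSpace Y₀] [MulAction G Y₀] [MeasurableSMul₂ G Y₀]

theorem measurableSet_essContracts (D : Kernel Y X) [IsMarkovKernel D] {f : X → ℝ}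
    (hf : Measurable f) (b : ℝ) :
    MeasurableSet {y | (∀ᵐ g ∂(rightHaar G), ∫ x, f x ∂(conjDisintegration D g y) ≤ b) →
      ∀ᵐ x ∂(D y), f x ≤ b} := by
  have h1 : MeasurableSet {y | ∀ᵐ x ∂(D y), f x ≤ b} :=
    Kernel.measurable_coe D (measurableSet_le hf measurable_const).compl
      (measurableSet_singleton 0)
  have h2 : {y | (∀ᵐ g ∂(rightHaar G), ∫ x, f x ∂(conjDisintegration D g y) ≤ b) →
      ∀ᵐ x ∂(D y), f x ≤ b}
      = {y | ∀ᵐ g ∂(rightHaar G), ∫ x, f x ∂(conjDisintegration D g y) ≤ b}ᶜ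
        ∪ {y | ∀ᵐ x ∂(D y), f x ≤ b} := by
    ext y; simp only [Set.mem_ofPred_eq, Set.mem_union, Set.mem_compl_iff, imp_iff_not_or]
  rw [h2]
  exact (measurableSet_ae_integral_conjDisintegration_le D hf b).compl.union h1

/-- Essential contraction is not affected by `G`-maps that intertwine the disintegrations. -/
theorem essContracts_iff_of_map [MeasurableEq X₀] [MeasurableEq Y₀]
    {ν : Measure X} {η : Measure Y} [SFinite η] {ν₀ : Measure X₀} {η₀ : Measure Y₀}
    (hν : ∀ g : G, Measure.QuasiMeasurePreserving (fun x : X => g • x) ν ν)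
    (hη : ∀ g : G, Measure.QuasiMeasurePreserving (fun y : Y => g • y) η η)
    {φ : X → X₀} (hφ : IsGMap G ν ν₀ φ) {ψ : Y → Y₀} (hψ : IsGMap G η η₀ ψ)
    {D : Kernel Y X} [IsMarkovKernel D] (hD : η.bind D = ν)
    {D₀ : Kernel Y₀ X₀} [IsMarkovKernel D₀] (hDD : ∀ᵐ y ∂η, D₀ (ψ y) = (D y).map φ)
    {q : X₀ → ℝ} (hq : Measurable q) {f : X → ℝ}
    (hqf : ∀ᵐ x ∂ν, q (φ x) = f x) :
    EssContracts G η₀ D₀ q ↔ EssContracts G η D f := by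
  have hm : Measurable fun p : G × X => p.1⁻¹ • p.2 := measurable_fst.inv.smul measurable_snd
  have hm₀ : Measurable fun p : G × X₀ => p.1⁻¹ • p.2 := measurable_fst.inv.smul measurable_snd
  have h1 : ∀ᵐ y ∂η, ∀ᵐ g ∂(rightHaar G), ψ (g • y) = g • ψ y := by
    refine (Measure.ae_ae_comm (p := fun (g : G) y => ψ (g • y) = g • ψ y) ?_).1
      (Eventually.of_forall hψ.equivariant)
    exact measurableSet_eq_fun (hψ.measurable.comp measurable_smul_prod)
      (measurable_fst.smul (hψ.measurable.comp measurable_snd))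
  have h2 := ae_ae_smul hη hDD
  have h3 : ∀ᵐ y ∂η, ∀ᵐ g ∂(rightHaar G), ∀ᵐ x ∂(D (g • y)), φ (g⁻¹ • x) = g⁻¹ • φ x :=
    ae_ae_ae_fibre hη hD (p := fun (g : G) x => φ (g⁻¹ • x) = g⁻¹ • φ x)
      (measurableSet_eq_fun (hφ.measurable.comp hm)
        (measurable_fst.inv.smul (hφ.measurable.comp measurable_snd)))
      fun g => hφ.equivariant g⁻¹
  have h4 := ae_ae_ae_conjDisintegration (G := G) hν hη hD hqf
  have hqfD := hqf
  rw [← hD] at hqfD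
  have h5 := Measure.ae_ae_of_ae_bind D.measurable.aemeasurable hqfD
  have key : ∀ᵐ y ∂η, ∀ b : ℝ,
      ((∀ᵐ g ∂(rightHaar G), ∫ x, q x ∂(conjDisintegration D₀ g (ψ y)) ≤ b) →
        ∀ᵐ x ∂(D₀ (ψ y)), q x ≤ b) ↔
      ((∀ᵐ g ∂(rightHaar G), ∫ x, f x ∂(conjDisintegration D g y) ≤ b) →
        ∀ᵐ x ∂(D y), f x ≤ b) := by
    filter_upwards [h1, h2, h3, h4, h5, hDD] with y h1 h2 h3 h4 h5 h6 b
    have e1 : ∀ᵐ g ∂(rightHaar G), ∫ x, q x ∂(conjDisintegration D₀ g (ψ y))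
        = ∫ x, f x ∂(conjDisintegration D g y) := by
      filter_upwards [h1, h2, h3, h4] with g g1 g2 g3 g4
      have hqg : Measurable fun z => q (g⁻¹ • z) := hq.comp (measurable_const_smul g⁻¹)
      rw [integral_conjDisintegration D₀ hq, ← g1, g2,
        integral_map hφ.measurable.aemeasurable hqg.aestronglyMeasurable,
        ← integral_congr_ae g4, integral_conjDisintegration D (f := fun x => q (φ x))
          (hq.comp hφ.measurable)]
      refine integral_congr_ae ?_
      filter_upwards [g3] with x hx
      rw [hx]
    have e2 : (∀ᵐ g ∂(rightHaar G), ∫ x, q x ∂(conjDisintegration D₀ g (ψ y)) ≤ b) ↔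
        ∀ᵐ g ∂(rightHaar G), ∫ x, f x ∂(conjDisintegration D g y) ≤ b :=
      eventually_congr (e1.mono fun g hg => by rw [hg])
    have e3 : (∀ᵐ x ∂(D₀ (ψ y)), q x ≤ b) ↔ ∀ᵐ x ∂(D y), f x ≤ b := by
      rw [h6, ae_map_iff hφ.measurable.aemeasurable (measurableSet_le hq measurable_const)]
      exact eventually_congr (h5.mono fun x hx => by rw [hx])
    rw [e2, e3]
  refine forall_congr' fun b => ?_
  rw [← hψ.map_eq, ae_map_iff hψ.measurable.aemeasurable (measurableSet_essContracts D₀ hq b)]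
  exact eventually_congr (key.mono fun y hy => hy b)

/-- Relative contractivity gives essential contraction of functions continuous along orbits. -/
theorem RelativelyContractive.essContracts {ν : Measure X} {η : Measure Y} [IsProbabilityMeasure η]
    (hη : ∀ g : G, Measure.QuasiMeasurePreserving (fun y : Y => g • y) η η) {π : X → Y}
    (h : RelativelyContractive G ν η π) {D : Kernel Y X} (hD : IsDisintegration ν η π D)
    {f : X → ℝ} (hf : Measurable f) (hf1 : ∀ x, f x ∈ Set.Icc (0 : ℝ) 1)
    (hfc : ∀ x, Continuous fun g : G => f (g • x)) : EssContracts G η D f := by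
  have := hD.isMarkovKernel
  intro b
  obtain ⟨D', hD'M, hD'D, hD'b⟩ := exists_version_forall_le hη D hf hf1 hfc b
  have hD' : IsDisintegration ν η π D' := by
    refine ⟨hD'M, ?_, ?_⟩
    · filter_upwards [hD'D, hD.concentrated] with y h1 h2
      rwa [h1]
    · rw [← hD.bind_eq]
      exact Measure.bind_congr_right hD'D
  filter_upwards [hD'D, hD'b, h D' hD'] with y h1 h2 h3 h4
  have h5 := h2 h4
  have hb0 : 0 ≤ b := (integral_nonneg fun x => (hf1 x).1).trans (h5 1)
  have hq : ∀ c : ℚ, b < c → D' y {x | (c : ℝ) < f x} = 0 := by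
    intro c hc
    by_contra hne
    have hm : MeasurableSet {x | (c : ℝ) < f x} := measurableSet_lt measurable_const hf
    have hc0 : (0 : ℝ) < c := hb0.trans_lt hc
    have hlt : ENNReal.ofReal (b / c) < ⨆ g : G, conjDisintegration D' g y {x | (c : ℝ) < f x} := by
      rw [h3 _ hm (pos_iff_ne_zero.2 hne), ← ENNReal.ofReal_one]
      exact (ENNReal.ofReal_lt_ofReal_iff zero_lt_one).2 ((div_lt_one hc0).2 hc)
    obtain ⟨g, hg⟩ := lt_iSup_iff.1 hlt
    have h6 : b / c < (conjDisintegration D' g y).real {x | (c : ℝ) < f x} :=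
      (ENNReal.ofReal_lt_iff_lt_toReal (div_nonneg hb0 hc0.le) (measure_ne_top _ _)).1 hg
    have h7 : (c : ℝ) * (conjDisintegration D' g y).real {x | (c : ℝ) ≤ f x}
        ≤ ∫ x, f x ∂(conjDisintegration D' g y) :=
      mul_meas_ge_le_integral_of_nonneg (Eventually.of_forall fun x => (hf1 x).1)
        (Integrable.of_mem_Icc 0 1 hf.aemeasurable (Eventually.of_forall hf1)) c
    have h8 : (conjDisintegration D' g y).real {x | (c : ℝ) < f x}
        ≤ (conjDisintegration D' g y).real {x | (c : ℝ) ≤ f x} :=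
      measureReal_mono fun x (hx : (c : ℝ) < f x) => hx.le
    have h9 := h5 g
    rw [div_lt_iff₀ hc0] at h6
    nlinarith
  have h10 : ∀ᵐ x ∂(D' y), ∀ c : ℚ, b < c → f x ≤ c := by
    refine ae_all_iff.2 fun c => ?_
    by_cases hc : b < c
    · have : ∀ᵐ x ∂(D' y), f x ≤ c := by
        rw [ae_iff]; simpa using hq c hc
      filter_upwards [this] with x hx _ using hx
    · exact Eventually.of_forall fun x h => absurd h hc
  rw [h1] at h10
  filter_upwards [h10] with x hx
  refine le_of_forall_gt_imp_ge_of_dense fun c hc => ?_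
  obtain ⟨r, hr1, hr2⟩ := exists_rat_btwn hc
  exact (hx r hr1).trans hr2.le

end Transfer

/-! ### Contraction in compact models -/

section Models

variable {G : Type*} [Group G] [TopologicalSpace G] [IsTopologicalGroup G] [T2Space G]
  [LocallyCompactSpace G] [SecondCountableTopology G] [MeasurableSpace G] [BorelSpace G]
  {X : Type*} [MetricSpace X] [CompactSpace X] [MeasurableSpace X] [BorelSpace X]
  [MulAction G X] [MeasurableSMul₂ G X]
  {Y : Type*} [MeasurableSpace Y] [MulAction G Y] [MeasurableSMul₂ G Y]

/-- Relative contractibility of a compact model gives essential contraction of continuous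
functions. -/
theorem RelativelyContractible.essContracts [ContinuousSMul G X] {ν : Measure X} {η : Measure Y}
    [IsProbabilityMeasure η]
    (hη : ∀ g : G, Measure.QuasiMeasurePreserving (fun y : Y => g • y) η η) {π : X → Y}
    (h : RelativelyContractible G ν η π) {D : Kernel Y X} (hD : IsDisintegration ν η π D)
    {f : X → ℝ} (hf : Continuous f) (hf1 : ∀ x, f x ∈ Set.Icc (0 : ℝ) 1) :
    EssContracts G η D f := by
  have := hD.isMarkovKernel
  intro b
  obtain ⟨D', hD'M, hD'D, hD'b⟩ := exists_version_forall_le hη D hf.measurable hf1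
    (fun x => hf.comp (continuous_id.smul continuous_const)) b
  have hD' : IsDisintegration ν η π D' := by
    refine ⟨hD'M, ?_, ?_⟩
    · filter_upwards [hD'D, hD.concentrated] with y h1 h2
      rwa [h1]
    · rw [← hD.bind_eq]
      exact Measure.bind_congr_right hD'D
  filter_upwards [hD'D, hD'b, h D' hD'] with y h1 h2 h3 h4
  rw [← h1]
  filter_upwards [Measure.support_mem_ae (μ := D' y)] with x hx
  obtain ⟨g, hg⟩ := h3 x hx
  exact le_of_tendsto' (hg ⟨f, hf⟩) fun n => h2 h4 (g n)

theorem tendsto_integral_of_tendsto_measureReal_ball {μ : ℕ → Measure X}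
    [∀ n, IsProbabilityMeasure (μ n)] {x : X} {r : ℕ → ℝ} (hr : Tendsto r atTop (𝓝 0))
    (hμ : Tendsto (fun n => (μ n).real (Metric.ball x (r n))) atTop (𝓝 1)) (f : C(X, ℝ)) :
    Tendsto (fun n => ∫ z, f z ∂(μ n)) atTop (𝓝 (f x)) := by
  rw [Metric.tendsto_atTop']
  intro ε hε
  obtain ⟨δ, hδ, hfδ⟩ := Metric.continuousAt_iff.1 f.continuous.continuousAt (ε / 2) (half_pos hε)
  have hlim : Tendsto (fun n => ε / 2 + 2 * ‖f‖ * (1 - (μ n).real (Metric.ball x (r n)))) atTop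
      (𝓝 (ε / 2)) := by
    simpa using ((hμ.const_sub 1).const_mul (2 * ‖f‖)).const_add (ε / 2)
  obtain ⟨N, hN⟩ := eventually_atTop.1 ((hlim.eventually_lt_const (half_lt_self hε)).and
    (hr.eventually_lt_const hδ))
  refine ⟨N, fun n hn => ?_⟩
  obtain ⟨h1, h2⟩ := hN n hn.le
  refine lt_of_le_of_lt ?_ h1
  have hi : Integrable (fun z => f z) (μ n) := (f.continuous.integrable_of_hasCompactSupport
    (HasCompactSupport.of_compactSpace f))
  have hB : MeasurableSet (Metric.ball x (r n)) := Metric.isOpen_ball.measurableSet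
  have e1 : ∫ z, f z ∂(μ n) - f x = ∫ z, (f z - f x) ∂(μ n) := by
    rw [integral_sub hi (integrable_const _)]; simp
  have hi2 : Integrable (fun z => |f z - f x|) (μ n) := (hi.sub (integrable_const _)).abs
  have hi4 : Integrable (fun z => 2 * ‖f‖ * ((Metric.ball x (r n))ᶜ).indicator 1 z) (μ n) :=
    ((integrable_indicator_iff hB.compl).2 (integrable_const (1 : ℝ)).integrableOn).const_mul _
  have hi3 : Integrable (fun z => ε / 2 + 2 * ‖f‖ * ((Metric.ball x (r n))ᶜ).indicator 1 z)
      (μ n) := (integrable_const _).add hi4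
  rw [Real.dist_eq, e1]
  refine abs_integral_le_integral_abs.trans ((integral_mono hi2 hi3 fun z => ?_).trans_eq ?_)
  · by_cases hz : z ∈ Metric.ball x (r n)
    · have : dist z x < δ := (Metric.mem_ball.1 hz).trans h2
      have h3 := (hfδ this).le
      rw [Real.dist_eq] at h3
      simpa [hz] using h3
    · have h3 := f.norm_coe_le_norm z
      have h4 := f.norm_coe_le_norm x
      have h5 := norm_sub_le (f z) (f x)
      simp only [Real.norm_eq_abs] at h3 h4 h5
      have h6 : ((Metric.ball x (r n))ᶜ).indicator (1 : X → ℝ) z = 1 := by simp [hz]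
      simp only [h6]
      linarith
  · rw [integral_add (integrable_const _) hi4, integral_const_mul,
      integral_indicator_one hB.compl, probReal_compl_eq_one_sub hB]
    simp

/-- Essential contraction of the indicators of basic open sets gives the convergence to point
masses that defines relative contractibility. -/
theorem ae_forall_mem_support_exists_tendsto {η : Measure Y} {D : Kernel Y X} [IsMarkovKernel D]
    (h : ∀ φ : X → ℝ, Measurable φ → (∀ x, φ x ∈ Set.Icc (0 : ℝ) 1) → EssContracts G η D φ) :
    ∀ᵐ y ∂η, ∀ x ∈ (D y).support, ∃ g : ℕ → G, ∀ f : C(X, ℝ),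
      Tendsto (fun n => ∫ z, f z ∂(conjDisintegration D (g n) y)) atTop (𝓝 (f x)) := by
  obtain ⟨𝓑, h𝓑c, -, h𝓑⟩ := TopologicalSpace.exists_countable_basis X
  have : Countable 𝓑 := h𝓑c
  have hm : ∀ U : 𝓑, MeasurableSet (U : Set X) := fun U => (h𝓑.isOpen U.2).measurableSet
  have h1 : ∀ᵐ y ∂η, ∀ U : 𝓑, ∀ n : ℕ, D y U ≠ 0 →
      ∃ g : G, 1 - 1 / ((n : ℝ) + 1) < (conjDisintegration D g y).real U := by
    refine ae_all_iff.2 fun U => ae_all_iff.2 fun n => ?_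
    filter_upwards [h ((U : Set X).indicator 1) (measurable_one.indicator (hm U)) (fun x => by
      by_cases hx : x ∈ (U : Set X) <;> simp [hx]) (1 - 1 / ((n : ℝ) + 1))] with y hy hU
    by_contra! hc
    refine hU ?_
    have h2 := hy (Eventually.of_forall fun g => by
      rw [integral_indicator_one (hm U)]; exact hc g)
    refine measure_mono_null (fun x hx => ?_) (ae_iff.1 h2)
    have : (0 : ℝ) < 1 / ((n : ℝ) + 1) := Nat.one_div_pos_of_nat
    simp only [Set.mem_ofPred_eq, Set.indicator_of_mem hx, Pi.one_apply]
    linarith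
  filter_upwards [h1] with y hy x hx
  have h2 : ∀ n : ℕ, ∃ g : G, 1 - 1 / ((n : ℝ) + 1)
      < (conjDisintegration D g y).real (Metric.ball x (1 / ((n : ℝ) + 1))) := by
    intro n
    obtain ⟨U, hU, hxU, hUb⟩ := h𝓑.mem_nhds_iff.1
      (Metric.ball_mem_nhds x (Nat.one_div_pos_of_nat (α := ℝ) (n := n)))
    have h3 : 0 < D y U := (Measure.mem_support_iff_forall x).1 hx U ((h𝓑.isOpen hU).mem_nhds hxU)
    obtain ⟨g, hg⟩ := hy ⟨U, hU⟩ n h3.ne'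
    exact ⟨g, hg.trans_le (measureReal_mono hUb)⟩
  choose g hg using h2
  refine ⟨g, tendsto_integral_of_tendsto_measureReal_ball
    tendsto_one_div_add_atTop_nhds_zero_nat ?_⟩
  refine tendsto_of_tendsto_of_tendsto_of_le_of_le ?_ tendsto_const_nhds (fun n => (hg n).le)
    fun n => measureReal_le_one
  simpa using (tendsto_one_div_add_atTop_nhds_zero_nat (𝕜 := ℝ)).const_sub 1

end Models

/-! ### A compact space of functions on the group -/

section OrbitFunctions

variable {G : Type*} [Group G] [TopologicalSpace G] [IsTopologicalGroup G] [T2Space G]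
  [LocallyCompactSpace G] [SecondCountableTopology G] [MeasurableSpace G] [BorelSpace G]

/-- The space of sequences of functions `G → [0, 1]` the `n`-th of which has the modulus of
continuity `orbitModulus (ρ n)`, with the topology of pointwise convergence. It contains the
sequences `g ↦ orbitAverage (ρ n) (φ n) (g • x)`. -/
def OrbitFunctions (ρ : ℕ → {ρ : G → ℝ // IsBump ρ}) : Type _ :=
  {u : ℕ → G → ℝ // ∀ n, (∀ g, u n g ∈ Set.Icc (0 : ℝ) 1) ∧
    ∀ g g', |u n g - u n g'| ≤ orbitModulus (ρ n : G → ℝ) g g'}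

namespace OrbitFunctions

variable {ρ : ℕ → {ρ : G → ℝ // IsBump ρ}}

instance : TopologicalSpace (OrbitFunctions ρ) :=
  inferInstanceAs (TopologicalSpace (Subtype _))

instance : T2Space (OrbitFunctions ρ) := inferInstanceAs (T2Space (Subtype _))

theorem continuous_eval (n : ℕ) (g : G) : Continuous fun u : OrbitFunctions ρ => u.1 n g :=
  (continuous_apply_apply n g).comp continuous_subtype_val

instance : CompactSpace (OrbitFunctions ρ) := by
  have hK : IsCompact (Set.univ.pi fun _ : ℕ => Set.univ.pi fun _ : G => Set.Icc (0 : ℝ) 1) :=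
    isCompact_univ_pi fun _ => isCompact_univ_pi fun _ => isCompact_Icc
  have he : ∀ (n : ℕ) (g : G), Continuous fun u : ℕ → G → ℝ => u n g := continuous_apply_apply
  have hc : IsClosed {u : ℕ → G → ℝ | ∀ n, (∀ g, u n g ∈ Set.Icc (0 : ℝ) 1) ∧
      ∀ g g', |u n g - u n g'| ≤ orbitModulus (ρ n : G → ℝ) g g'} := by
    rw [Set.ofPred_forall]
    refine isClosed_iInter fun n => ?_
    rw [Set.ofPred_and, Set.ofPred_forall, Set.ofPred_forall]
    refine IsClosed.inter (isClosed_iInter fun g => isClosed_Icc.preimage (he n g))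
      (isClosed_iInter fun g => ?_)
    rw [Set.ofPred_forall]
    exact isClosed_iInter fun g' => isClosed_le ((he n g).sub (he n g')).abs continuous_const
  exact isCompact_iff_compactSpace.1 (hK.of_isClosed_subset hc fun u hu n _ g _ => (hu n).1 g)

theorem continuous_apply (u : OrbitFunctions ρ) (n : ℕ) : Continuous (u.1 n) := by
  refine continuous_iff_continuousAt.2 fun g => ?_
  rw [ContinuousAt, tendsto_iff_dist_tendsto_zero]
  exact squeeze_zero (fun _ => dist_nonneg) (fun g' => (u.2 n).2 g' g)
    ((ρ n).2.tendsto_orbitModulus g)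

/-- Restriction of the functions to a countable dense subset of `G`. -/
noncomputable def restrictDense (u : OrbitFunctions ρ) : ℕ → ℕ → ℝ :=
  fun n k => u.1 n (TopologicalSpace.denseSeq G k)

theorem isClosedEmbedding_restrictDense :
    IsClosedEmbedding (restrictDense : OrbitFunctions ρ → ℕ → ℕ → ℝ) := by
  refine Continuous.isClosedEmbedding
    (continuous_pi fun n => continuous_pi fun k => continuous_eval n _) fun u v huv => ?_
  refine Subtype.ext (funext fun n => ?_)
  refine (TopologicalSpace.denseRange_denseSeq G).equalizer (u.continuous_apply n)
    (v.continuous_apply n) (funext fun k => ?_)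
  exact congrFun (congrFun huv n) k

instance : TopologicalSpace.MetrizableSpace (OrbitFunctions ρ) :=
  isClosedEmbedding_restrictDense.isEmbedding.metrizableSpace

instance : MeasurableSpace (OrbitFunctions ρ) := borel _

instance : BorelSpace (OrbitFunctions ρ) := ⟨rfl⟩

instance : MulAction G (OrbitFunctions ρ) where
  smul k u := ⟨fun n g => u.1 n (g * k), fun n => ⟨fun g => (u.2 n).1 _, fun g g' => by
    have := (u.2 n).2 (g * k) (g' * k)
    rwa [orbitModulus_mul_right] at this⟩⟩
  one_smul u := Subtype.ext (funext fun n => funext fun g => congrArg (u.1 n) (mul_one g))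
  mul_smul k l u := Subtype.ext (funext fun n => funext fun g =>
    congrArg (u.1 n) (mul_assoc g k l).symm)

theorem smul_apply (k : G) (u : OrbitFunctions ρ) (n : ℕ) (g : G) :
    (k • u).1 n g = u.1 n (g * k) := rfl

instance : ContinuousSMul G (OrbitFunctions ρ) := by
  refine ⟨Continuous.subtype_mk (continuous_pi fun n => continuous_pi fun g => ?_) _⟩
  refine continuous_iff_continuousAt.2 fun ⟨k, u⟩ => ?_
  -- The functions are equicontinuous, so evaluation is jointly continuous.
  have h1 : Tendsto (fun p : G × OrbitFunctions ρ => orbitModulus (ρ n : G → ℝ) (g * p.1) (g * k)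
      + dist (p.2.1 n (g * k)) (u.1 n (g * k))) (𝓝 (k, u)) (𝓝 (0 + 0)) := by
    refine Tendsto.add ?_ ?_
    · have h2 : Tendsto (fun p : G × OrbitFunctions ρ => g * p.1) (𝓝 (k, u)) (𝓝 (g * k)) :=
        ((continuous_const_mul g).comp continuous_fst).tendsto _
      exact ((ρ n).2.tendsto_orbitModulus (g * k)).comp h2
    · have h3 : Tendsto (fun p : G × OrbitFunctions ρ => p.2.1 n (g * k)) (𝓝 (k, u))
          (𝓝 (u.1 n (g * k))) := ((continuous_eval n (g * k)).comp continuous_snd).tendsto _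
      exact tendsto_iff_dist_tendsto_zero.1 h3
  rw [add_zero] at h1
  rw [ContinuousAt, tendsto_iff_dist_tendsto_zero]
  refine squeeze_zero (fun _ => dist_nonneg) (fun p => ?_) h1
  exact (dist_triangle _ (p.2.1 n (g * k)) _).trans (add_le_add_left ((p.2.2 n).2 _ _) _)

end OrbitFunctions

variable {X : Type*} [MeasurableSpace X] [MulAction G X] [MeasurableSMul₂ G X]

/-- The averages of a sequence of functions along the orbit of a point. -/
noncomputable def orbitMap (ρ : ℕ → {ρ : G → ℝ // IsBump ρ})
    (φ : ℕ → {φ : X → ℝ // Measurable φ ∧ ∀ x, φ x ∈ Set.Icc (0 : ℝ) 1}) (x : X) :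
    OrbitFunctions ρ :=
  ⟨fun n g => orbitAverage (ρ n : G → ℝ) (φ n : X → ℝ) (g • x), fun n =>
    ⟨fun _ => (ρ n).2.orbitAverage_mem_Icc (φ n).2.1 (φ n).2.2 _,
      fun g g' => (ρ n).2.abs_orbitAverage_sub_le (φ n).2.1 (φ n).2.2 x g g'⟩⟩

theorem orbitMap_smul (ρ : ℕ → {ρ : G → ℝ // IsBump ρ})
    (φ : ℕ → {φ : X → ℝ // Measurable φ ∧ ∀ x, φ x ∈ Set.Icc (0 : ℝ) 1}) (k : G) (x : X) :
    orbitMap ρ φ (k • x) = k • orbitMap ρ φ x :=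
  Subtype.ext (funext fun n => funext fun g => by
    rw [OrbitFunctions.smul_apply]
    simp only [orbitMap, mul_smul])

theorem measurable_orbitMap (ρ : ℕ → {ρ : G → ℝ // IsBump ρ})
    (φ : ℕ → {φ : X → ℝ // Measurable φ ∧ ∀ x, φ x ∈ Set.Icc (0 : ℝ) 1}) :
    Measurable (orbitMap ρ φ) := by
  refine (OrbitFunctions.isClosedEmbedding_restrictDense.measurableEmbedding.measurable_comp_iff).1
    (measurable_pi_iff.2 fun n => measurable_pi_iff.2 fun k => ?_)
  exact (measurable_orbitAverage (ρ n).2.continuous (φ n).2.1).comp (measurable_const_smul _)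

end OrbitFunctions

/-! ### Compact models -/

section Realization

variable {G : Type*} [Group G] [TopologicalSpace G] [IsTopologicalGroup G] [T2Space G]
  [LocallyCompactSpace G] [SecondCountableTopology G] [MeasurableSpace G] [BorelSpace G]

/-- An almost everywhere equivariant and almost everywhere injective map to a compact metrizable
`G`-space gives a compact model, namely the support of the image measure. The model may be taken in
any universe since its cardinality is at most that of the continuum. -/
theorem exists_isPointRealization {X : Type*} [MeasurableSpace X] [MulAction G X]
    {ν : Measure X} (hν : IsGSpace G ν)
    {P : Type*} [TopologicalSpace P] [CompactSpace P] [TopologicalSpace.MetrizableSpace P]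
    [MeasurableSpace P] [BorelSpace P] [MulAction G P] [ContinuousSMul G P]
    {Φ : X → P} (hΦ : Measurable Φ) (hequiv : ∀ g : G, ∀ᵐ x ∂ν, Φ (g • x) = g • Φ x)
    {θ : P → X} (hθ : Measurable θ) (hinv : ∀ᵐ x ∂ν, θ (Φ x) = x) :
    ∃ (X₀ : Type w) (_ : MetricSpace X₀) (_ : CompactSpace X₀) (_ : MeasurableSpace X₀)
      (_ : BorelSpace X₀) (_ : MulAction G X₀) (ν₀ : Measure X₀) (φ : X → X₀) (j : X₀ → P),
      IsPointRealization G ν ν₀ φ ∧ IsEmbedding j ∧ Set.range j = (ν.map Φ).support ∧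
        (∀ (g : G) (z : X₀), j (g • z) = g • j z) ∧ ∀ᵐ x ∂ν, j (φ x) = Φ x := by
  classical
  have := hν.isProbabilityMeasure
  let : MetricSpace P := TopologicalSpace.metrizableSpaceMetric P
  set m : Measure P := ν.map Φ with hm
  have hmP : IsProbabilityMeasure m := Measure.isProbabilityMeasure_map hΦ.aemeasurable
  set S : Set P := m.support with hS
  have hSc : IsClosed S := Measure.isClosed_support
  have hms : ∀ (g : G) (s : Set P), MeasurableSet s → m ((fun z => g • z) ⁻¹' s) ≠ 0 → m s ≠ 0 := by
    intro g s hs h h0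
    refine h ?_
    rw [hm, Measure.map_apply hΦ hs] at h0
    rw [hm, Measure.map_apply hΦ (hs.preimage (measurable_const_smul g))]
    have h1 := (hν.quasiInvariant g).preimage_null h0
    refine measure_mono_null_ae ?_ h1
    filter_upwards [hequiv g] with x hx hxs
    have : Φ (g • x) ∈ s := by rw [hx]; exact hxs
    exact this
  have hSinv : ∀ (g : G), ∀ z ∈ S, g • z ∈ S := by
    intro g z hz
    refine (Measure.mem_support_iff_forall _).2 fun U hU => ?_
    obtain ⟨V, hVU, hVo, hzV⟩ := mem_nhds_iff.1 hU
    have h1 : (fun z : P => g • z) ⁻¹' V ∈ 𝓝 z :=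
      (hVo.preimage (continuous_const_smul g)).mem_nhds hzV
    have h2 := (Measure.mem_support_iff_forall z).1 hz _ h1
    exact (pos_iff_ne_zero.2 (hms g V hVo.measurableSet h2.ne')).trans_le (measure_mono hVU)
  have : CompactSpace S := isCompact_iff_compactSpace.1 hSc.isCompact
  have : Small.{w} S := small_of_injective (β := ℝ)
    (f := fun z : S => embeddingReal P z)
    ((measurableEmbedding_embeddingReal P).injective.comp Subtype.val_injective)
  let e : S ≃ₜ Shrink.{w} S := Shrink.homeomorph S
  have : TopologicalSpace.MetrizableSpace (Shrink.{w} S) := e.symm.isEmbedding.metrizableSpace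
  let : MetricSpace (Shrink.{w} S) := TopologicalSpace.metrizableSpaceMetric _
  have hcomp : CompactSpace (Shrink.{w} S) := e.compactSpace
  let : MeasurableSpace (Shrink.{w} S) := borel _
  have hborel : BorelSpace (Shrink.{w} S) := ⟨rfl⟩
  let act : MulAction G (Shrink.{w} S) :=
    { smul := fun g z => e ⟨g • (e.symm z : P), hSinv g _ (e.symm z).2⟩
      one_smul := fun z => by
        change e ⟨(1 : G) • (e.symm z : P), _⟩ = z
        simp
      mul_smul := fun g h z => by
        change e ⟨(g * h) • (e.symm z : P), _⟩
          = e ⟨g • (e.symm (e ⟨h • (e.symm z : P), _⟩) : P), _⟩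
        simp [mul_smul] }
  set j : Shrink.{w} S → P := fun z => (e.symm z : P) with hj
  have hjsmul : ∀ (g : G) (z : Shrink.{w} S), j (g • z) = g • j z := by
    intro g z
    change ((e.symm (e ⟨g • (e.symm z : P), _⟩) : S) : P) = _
    simp [hj]
  have hje : IsClosedEmbedding j := hSc.isClosedEmbedding_subtypeVal.comp e.symm.isClosedEmbedding
  have hjm := hje.measurableEmbedding
  have hjr : Set.range j = S := by
    rw [hj, show (fun z => (e.symm z : P)) = Subtype.val ∘ e.symm from rfl, Set.range_comp,
      e.symm.surjective.range_eq, Set.image_univ, Subtype.range_coe]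
  obtain ⟨z₀, hz₀⟩ : S.Nonempty := Measure.nonempty_support (IsProbabilityMeasure.ne_zero m)
  have hex : ∀ x, ∃ z, j z = if Φ x ∈ S then Φ x else z₀ := by
    intro x
    have : (if Φ x ∈ S then Φ x else z₀) ∈ S := by split_ifs with h <;> assumption
    exact hjr.ge this
  choose φ hφ using hex
  have hφm : Measurable φ := by
    refine hjm.measurable_comp_iff.1 ?_
    have : j ∘ φ = fun x => if Φ x ∈ S then Φ x else z₀ := funext hφ
    rw [this]
    exact Measurable.ite (hΦ hSc.measurableSet) hΦ measurable_const
  have hφae : ∀ᵐ x ∂ν, j (φ x) = Φ x := by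
    have : ∀ᵐ z ∂m, z ∈ S := Measure.support_mem_ae
    filter_upwards [ae_of_ae_map hΦ.aemeasurable this] with x hx
    rw [hφ, if_pos hx]
  have hcs : ContinuousSMul G (Shrink.{w} S) := by
    refine ⟨hje.isEmbedding.continuous_iff.2 ?_⟩
    have : (j ∘ fun p : G × Shrink.{w} S => p.1 • p.2) = fun p => p.1 • j p.2 :=
      funext fun p => hjsmul p.1 p.2
    rw [this]
    exact continuous_fst.smul (hje.continuous.comp continuous_snd)
  have hφeq : ∀ g : G, ∀ᵐ x ∂ν, φ (g • x) = g • φ x := by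
    intro g
    filter_upwards [hequiv g, hφae, (hν.quasiInvariant g).ae hφae] with x h1 h2 h3
    apply hje.injective
    rw [h3, h1, hjsmul, h2]
  have hνP : IsProbabilityMeasure (ν.map φ) := Measure.isProbabilityMeasure_map hφm.aemeasurable
  refine ⟨Shrink.{w} S, inferInstance, hcomp, inferInstance, hborel, act, ν.map φ, φ, j,
    ⟨hcs, ⟨hνP, ?_, fun g => ⟨measurable_const_smul g, ?_⟩⟩, ⟨fun U hU hne => ?_⟩,
      ⟨⟨hφm, rfl, hφeq⟩, θ ∘ j, hθ.comp hjm.measurable, ?_, ?_⟩⟩,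
    hje.isEmbedding, hjr, hjsmul, hφae⟩
  · exact measurable_smul
  · refine Measure.AbsolutelyContinuous.mk fun s hs h0 => ?_
    have hgs : MeasurableSet ((fun z : Shrink.{w} S => g • z) ⁻¹' s) :=
      hs.preimage (measurable_const_smul g)
    rw [Measure.map_apply (measurable_const_smul g) hs, Measure.map_apply hφm hgs]
    rw [Measure.map_apply hφm hs] at h0
    refine measure_mono_null_ae ?_ ((hν.quasiInvariant g).preimage_null h0)
    filter_upwards [hφeq g] with x hx hxs
    have : φ (g • x) ∈ s := by rw [hx]; exact hxs
    exact this
  · obtain ⟨V, hV, rfl⟩ := hje.isInducing.isOpen_iff.1 hU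
    obtain ⟨z, hz⟩ := hne
    have hzS : j z ∈ S := hjr ▸ Set.mem_range_self z
    have h1 := (Measure.mem_support_iff_forall _).1 hzS V (hV.mem_nhds hz)
    rw [Measure.map_apply hφm hU.measurableSet]
    rw [hm, Measure.map_apply hΦ hV.measurableSet] at h1
    intro h0
    refine h1.ne' (measure_mono_null_ae ?_ h0)
    filter_upwards [hφae] with x hx hxV
    have : j (φ x) ∈ V := by rw [hx]; exact hxV
    exact this
  · filter_upwards [hφae, hinv] with x h1 h2
    rw [Function.comp_apply, h1, h2]
  · refine (ae_map_iff hφm.aemeasurable (measurableSet_eq_fun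
      (hφm.comp (hθ.comp hjm.measurable)) measurable_id)).2 ?_
    filter_upwards [hφae, hinv] with x h1 h2
    simp only [Function.comp_apply, h1, h2, id]

end Realization

/-! ### The equivalence -/

section Equivalence

/-- The image of a disintegration under almost everywhere defined isomorphisms. Here `c` is the
inverse of `ψ`. -/
theorem IsDisintegration.map_comap {X Y X₀ Y₀ : Type*} [MeasurableSpace X] [MeasurableSpace Y]
    [MeasurableSpace X₀] [MeasurableSpace Y₀] [MeasurableEq Y₀]
    {ν : Measure X} {η : Measure Y} {π : X → Y} {D : Kernel Y X} (hD : IsDisintegration ν η π D)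
    {ν₀ : Measure X₀} {η₀ : Measure Y₀} {π₀ : X₀ → Y₀} (hπ₀ : Measurable π₀) {φ : X → X₀}
    (hφ : Measurable φ) (hφν : ν.map φ = ν₀) {c : Y₀ → Y} (hc : Measurable c) (hcη : η₀.map c = η)
    {ψ : Y → Y₀} (hψc : ∀ᵐ y ∂η₀, ψ (c y) = y) (hsq : ∀ᵐ x ∂ν, π₀ (φ x) = ψ (π x)) :
    IsDisintegration ν₀ η₀ π₀ ((D.comap c hc).map φ) := by
  have := hD.isMarkovKernel
  have hsqD := hsq
  rw [← hD.bind_eq] at hsqD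
  have h1 := Measure.ae_ae_of_ae_bind D.measurable.aemeasurable hsqD
  have h2 := hD.concentrated
  rw [← hcη] at h1 h2
  refine ⟨Kernel.IsMarkovKernel.map _ hφ, ?_, ?_⟩
  · filter_upwards [ae_of_ae_map hc.aemeasurable h1, ae_of_ae_map hc.aemeasurable h2, hψc]
      with y h3 h4 h5
    rw [Kernel.map_apply _ hφ, Kernel.comap_apply]
    refine (ae_map_iff hφ.aemeasurable (measurableSet_eq_fun hπ₀ measurable_const)).2 ?_
    filter_upwards [h3, h4] with x h6 h7
    rw [h6, h7, h5]
  · ext s hs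
    rw [Measure.bind_apply hs (Kernel.aemeasurable _), ← hφν, Measure.map_apply hφ hs,
      ← hD.bind_eq, Measure.bind_apply (hφ hs) (Kernel.aemeasurable _), ← hcη,
      lintegral_map (Kernel.measurable_coe D (hφ hs)) hc]
    refine lintegral_congr fun y => ?_
    rw [Kernel.map_apply _ hφ, Kernel.comap_apply, Measure.map_apply hφ hs]

theorem map_map_eq_of_ae_eq {X X₀ : Type*} [MeasurableSpace X] [MeasurableSpace X₀]
    {ν : Measure X} {ν₀ : Measure X₀} {φ : X → X₀} (hφ : Measurable φ) (hφν : ν.map φ = ν₀)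
    {θ : X₀ → X} (hθ : Measurable θ) (h : ∀ᵐ x ∂ν, θ (φ x) = x) : ν₀.map θ = ν := by
  rw [← hφν, Measure.map_map hθ hφ, Measure.map_congr (show θ ∘ φ =ᵐ[ν] id from h), Measure.map_id]

variable {G : Type*} [Group G] [TopologicalSpace G] [IsTopologicalGroup G] [T2Space G]
  [LocallyCompactSpace G] [SecondCountableTopology G] [MeasurableSpace G] [BorelSpace G]
  {X : Type*} [MeasurableSpace X] [StandardBorelSpace X] [MulAction G X]
  {Y : Type*} [MeasurableSpace Y] [StandardBorelSpace Y] [MulAction G Y]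

/-- The averages along orbits of an injective function to `[0, 1]`, over shrinking neighbourhoods
of `1`, determine almost every point. -/
theorem exists_orbitMap_leftInverse [MeasurableSMul₂ G X] {ν : Measure X} [IsProbabilityMeasure ν]
    (hν : ∀ g : G, Measure.QuasiMeasurePreserving (fun x : X => g • x) ν ν) :
    ∃ (ρ : ℕ → {ρ : G → ℝ // IsBump ρ})
      (φ : {φ : X → ℝ // Measurable φ ∧ ∀ x, φ x ∈ Set.Icc (0 : ℝ) 1}) (r : ℝ → X),
      Measurable r ∧ ∀ᵐ x ∂ν,
        r (limsup (fun n => orbitAverage (ρ n : G → ℝ) (φ : X → ℝ) x) atTop) = x := by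
  have hemb := MeasurableEmbedding.subtype_coe (measurableSet_Icc (a := (0 : ℝ)) (b := 1)) |>.comp
    (measurableEmbedding_sigmoid_comp_embeddingReal X)
  set φ : X → ℝ := Subtype.val ∘ (unitInterval.sigmoid ∘ embeddingReal X) with hφ
  have hφ1 : ∀ x, φ x ∈ Set.Icc (0 : ℝ) 1 := fun x => Subtype.property _
  obtain ⟨V, hV, hVρ⟩ := exists_nhds_tendsto_orbitAverage hν hemb.measurable hφ1
  choose ρ hρ hρ0 using fun n => exists_isBump (hV n)
  have hne : Nonempty X := ν.nonempty_of_neZero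
  obtain ⟨r, hr, hrφ⟩ := hemb.exists_measurable_extend measurable_id fun _ => hne
  refine ⟨fun n => ⟨ρ n, hρ n⟩, ⟨φ, hemb.measurable, hφ1⟩, r, hr, ?_⟩
  filter_upwards [hVρ ρ hρ hρ0] with x hx
  rw [hx.limsup_eq]
  exact congrFun hrφ x

/-- If every compact model is relatively contractible, then averages along orbits are essentially
contracted: they become continuous in a suitable compact model. -/
theorem essContracts_orbitAverage_of_models [MeasurableSMul₂ G X] [MeasurableSMul₂ G Y]
    {ν : Measure X} {η : Measure Y} (hν : IsGSpace G ν) (hη : IsGSpace G η)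
    {π : X → Y} (hπ : IsGMap G ν η π)
    (h : ∀ (X₀ Y₀ : Type w)
        [MetricSpace X₀] [CompactSpace X₀] [MeasurableSpace X₀] [BorelSpace X₀] [MulAction G X₀]
        [MetricSpace Y₀] [CompactSpace Y₀] [MeasurableSpace Y₀] [BorelSpace Y₀] [MulAction G Y₀]
        (ν₀ : Measure X₀) (η₀ : Measure Y₀) (π₀ : X₀ → Y₀),
        IsPointRealizationMap G ν η π ν₀ η₀ π₀ → RelativelyContractible G ν₀ η₀ π₀)
    {D : Kernel Y X} (hD : IsDisintegration ν η π D) {ρ : G → ℝ} (hρ : IsBump ρ) {f : X → ℝ}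
    (hf : Measurable f) (hf1 : ∀ x, f x ∈ Set.Icc (0 : ℝ) 1) :
    EssContracts G η D (orbitAverage ρ f) := by
  have := hν.isProbabilityMeasure
  have := hη.isProbabilityMeasure
  have := hD.isMarkovKernel
  obtain ⟨ρX, bX, rX, hrX, hrX'⟩ := exists_orbitMap_leftInverse hν.quasiInvariant
  obtain ⟨ρY, bY, rY, hrY, hrY'⟩ := exists_orbitMap_leftInverse hη.quasiInvariant
  -- The first coordinate makes the average of `f` continuous, the others separate points.
  let ρX' : ℕ → {ρ : G → ℝ // IsBump ρ} := fun n => Nat.casesOn n ⟨ρ, hρ⟩ ρX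
  let fX : ℕ → {φ : X → ℝ // Measurable φ ∧ ∀ x, φ x ∈ Set.Icc (0 : ℝ) 1} :=
    fun n => Nat.casesOn n ⟨f, hf, hf1⟩ fun _ => bX
  let Ψ : Y → OrbitFunctions ρY := orbitMap ρY fun _ => bY
  have hΨ : Measurable Ψ := measurable_orbitMap _ _
  let Φ : X → OrbitFunctions ρX' × OrbitFunctions ρY := fun x => (orbitMap ρX' fX x, Ψ (π x))
  have hΦ : Measurable Φ := (measurable_orbitMap _ _).prodMk (hΨ.comp hπ.measurable)
  have hΦeq : ∀ g : G, ∀ᵐ x ∂ν, Φ (g • x) = g • Φ x := by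
    intro g
    filter_upwards [hπ.equivariant g] with x hx
    refine Prod.ext (orbitMap_smul ρX' fX g x) ?_
    change Ψ (π (g • x)) = g • Ψ (π x)
    rw [hx]
    exact orbitMap_smul ρY _ g (π x)
  obtain ⟨X₀, _, _, _, _, _, ν₀, φ, jX, hφ, hjX, hjXr, hjXs, hjXφ⟩ :=
    exists_isPointRealization.{w} hν hΦ hΦeq
      (θ := fun p => rX (limsup (fun n => p.1.1 (n + 1) 1) atTop))
      (hrX.comp (Measurable.limsup fun n =>
        (OrbitFunctions.continuous_eval _ _).measurable.comp measurable_fst)) (by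
        filter_upwards [hrX'] with x hx
        simpa [Φ, orbitMap, ρX', fX] using hx)
  obtain ⟨Y₀, _, _, _, _, _, η₀, ψ, jY, hψ, hjY, hjYr, hjYs, hjYψ⟩ :=
    exists_isPointRealization.{w} hη hΨ
      (fun g => Eventually.of_forall fun y => orbitMap_smul ρY _ g y)
      (θ := fun p => rY (limsup (fun n => p.1 n 1) atTop))
      (hrY.comp (Measurable.limsup fun n => (OrbitFunctions.continuous_eval _ _).measurable)) (by
        filter_upwards [hrY'] with y hy
        simpa [Ψ, orbitMap] using hy)
  have hsupp : ∀ z, ∃ y, jY y = (jX z).2 := by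
    intro z
    have hz : jX z ∈ (ν.map Φ).support := hjXr ▸ Set.mem_range_self z
    have : (jX z).2 ∈ (η.map Ψ).support := by
      refine (Measure.mem_support_iff_forall _).2 fun U hU => ?_
      obtain ⟨V, hVU, hVo, hzV⟩ := mem_nhds_iff.1 hU
      have h1 := (Measure.mem_support_iff_forall _).1 hz (Prod.snd ⁻¹' V)
        ((hVo.preimage continuous_snd).mem_nhds hzV)
      rw [Measure.map_apply hΦ (hVo.preimage continuous_snd).measurableSet] at h1
      refine lt_of_lt_of_le ?_ (measure_mono hVU)
      rw [Measure.map_apply hΨ hVo.measurableSet, ← hπ.map_eq,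
        Measure.map_apply hπ.measurable (hΨ hVo.measurableSet)]
      exact h1
    rw [← hjYr] at this
    exact this
  choose π₀ hπ₀ using hsupp
  have hπ₀c : Continuous π₀ := by
    refine hjY.continuous_iff.2 ?_
    rw [show jY ∘ π₀ = fun z => (jX z).2 from funext hπ₀]
    exact continuous_snd.comp hjX.continuous
  have hsq : ∀ᵐ x ∂ν, π₀ (φ x) = ψ (π x) := by
    have h1 := hjYψ
    rw [← hπ.map_eq] at h1
    filter_upwards [hjXφ, ae_of_ae_map hπ.measurable.aemeasurable h1] with x h2 h3
    apply hjY.injective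
    rw [hπ₀, h2, h3]
  have hφG := hφ.isGIso.isGMap
  have hψG := hψ.isGIso.isGMap
  have hcX := hφ.continuousSMul
  have hcY := hψ.continuousSMul
  have hmodel : IsPointRealizationMap G ν η π ν₀ η₀ π₀ := by
    refine ⟨hπ₀c, ⟨hπ₀c.measurable, ?_, fun g => Eventually.of_forall fun z => ?_⟩,
      φ, ψ, hφ, hψ, hsq⟩
    · rw [← hφG.map_eq, ← hψG.map_eq, ← hπ.map_eq, Measure.map_map hπ₀c.measurable hφG.measurable,
        Measure.map_map hψG.measurable hπ.measurable]
      exact Measure.map_congr hsq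
    · apply hjY.injective
      rw [hπ₀, hjXs, hjYs, hπ₀]
      rfl
  obtain ⟨c, hc, hcψ, hψc⟩ := hψ.isGIso.exists_inverse
  have hcη : η₀.map c = η := map_map_eq_of_ae_eq hψG.measurable hψG.map_eq hc hcψ
  have hD₀ : IsDisintegration ν₀ η₀ π₀ ((D.comap c hc).map φ) :=
    hD.map_comap hπ₀c.measurable hφG.measurable hφG.map_eq hc hcη hψc hsq
  have := hD₀.isMarkovKernel
  have := hψ.isGSpace.isProbabilityMeasure
  have hq : Continuous fun z => (jX z).1.1 0 1 :=
    (OrbitFunctions.continuous_eval 0 1).comp (continuous_fst.comp hjX.continuous)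
  have hess := (h X₀ Y₀ ν₀ η₀ π₀ hmodel).essContracts hψ.isGSpace.quasiInvariant hD₀ hq
    fun z => ((jX z).1.2 0).1 1
  refine (essContracts_iff_of_map hν.quasiInvariant hη.quasiInvariant hφG hψG hD.bind_eq ?_
    hq.measurable ?_).1 hess
  · filter_upwards [hcψ] with y hy
    rw [Kernel.map_apply _ hφG.measurable, Kernel.comap_apply, hy]
  · filter_upwards [hjXφ] with x hx
    simp [hx, Φ, orbitMap, ρX', fX]

end Equivalence

theorem theoremT
    {G : Type*} [Group G] [TopologicalSpace G] [IsTopologicalGroup G] [T2Space G]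
    [LocallyCompactSpace G] [SecondCountableTopology G] [MeasurableSpace G] [BorelSpace G]
    {X : Type*} [MeasurableSpace X] [StandardBorelSpace X] [MulAction G X]
    {Y : Type*} [MeasurableSpace Y] [StandardBorelSpace Y] [MulAction G Y]
    (ν : Measure X) (η : Measure Y) (hν : IsGSpace G ν) (hη : IsGSpace G η)
    (π : X → Y) (hπ : IsGMap G ν η π) :
    RelativelyContractive G ν η π ↔
      ∀ (X₀ Y₀ : Type w)
        [MetricSpace X₀] [CompactSpace X₀] [MeasurableSpace X₀] [BorelSpace X₀] [MulAction G X₀]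
        [MetricSpace Y₀] [CompactSpace Y₀] [MeasurableSpace Y₀] [BorelSpace Y₀] [MulAction G Y₀]
        (ν₀ : Measure X₀) (η₀ : Measure Y₀) (π₀ : X₀ → Y₀),
        IsPointRealizationMap G ν η π ν₀ η₀ π₀ → RelativelyContractible G ν₀ η₀ π₀ := by
  have : MeasurableSMul₂ G X := ⟨hν.measurable_smul⟩
  have : MeasurableSMul₂ G Y := ⟨hη.measurable_smul⟩
  have := hν.isProbabilityMeasure
  have := hη.isProbabilityMeasure
  constructor
  · intro h X₀ Y₀ _ _ _ _ _ _ _ _ _ _ ν₀ η₀ π₀ hmodel D₀ hD₀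
    obtain ⟨φ, ψ, hφ, hψ, hsq⟩ := hmodel.exists_iso
    have := hφ.continuousSMul
    have := hψ.continuousSMul
    have := hD₀.isMarkovKernel
    have hφG := hφ.isGIso.isGMap
    have hψG := hψ.isGIso.isGMap
    obtain ⟨θ, hθ, hθφ, hφθ⟩ := hφ.isGIso.exists_inverse
    obtain ⟨c, hc, hcψ, hψc⟩ := hψ.isGIso.exists_inverse
    have hθν : ν₀.map θ = ν := map_map_eq_of_ae_eq hφG.measurable hφG.map_eq hθ hθφ
    -- The given disintegration in the model comes from one of `ν` over `η`.
    have hD : IsDisintegration ν η π ((D₀.comap ψ hψG.measurable).map θ) := by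
      refine hD₀.map_comap hπ.measurable hθ hθν hψG.measurable hψG.map_eq (ψ := c) hcψ ?_
      have h1 : ∀ᵐ x ∂ν, c (ψ (π x)) = π x := by
        have := hcψ
        rw [← hπ.map_eq] at this
        exact ae_of_ae_map hπ.measurable.aemeasurable this
      have h2 : ∀ᵐ x ∂ν, π₀ (φ x) = ψ (π x) ∧ c (ψ (π x)) = π x := hsq.and h1
      rw [← hθν] at h2
      filter_upwards [ae_of_ae_map hθ.aemeasurable h2, hφθ] with z h3 h4
      rw [← h3.2, ← h3.1, h4]
    have := hD.isMarkovKernel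
    refine ae_forall_mem_support_exists_tendsto (G := G) fun q hq hq1 => ?_
    refine (essContracts_iff_of_map hν.quasiInvariant hη.quasiInvariant hφG hψG hD.bind_eq ?_
      hq (f := q ∘ φ) (Eventually.of_forall fun x => rfl)).2 ?_
    · have h1 := hφθ
      rw [← hD₀.bind_eq] at h1
      have h2 := Measure.ae_ae_of_ae_bind D₀.measurable.aemeasurable h1
      rw [← hψG.map_eq] at h2
      filter_upwards [ae_of_ae_map hψG.measurable.aemeasurable h2] with y hy
      rw [Kernel.map_apply _ hθ, Kernel.comap_apply, Measure.map_map hφG.measurable hθ,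
        Measure.map_congr (show φ ∘ θ =ᵐ[D₀ (ψ y)] id from hy), Measure.map_id]
    · exact essContracts_of_orbitAverage hν.quasiInvariant hη.quasiInvariant _ hD.bind_eq
        (hq.comp hφG.measurable) (fun x => hq1 _) fun ρ hρ =>
        h.essContracts hη.quasiInvariant hD
          (measurable_orbitAverage hρ.continuous (hq.comp hφG.measurable))
          (hρ.orbitAverage_mem_Icc (hq.comp hφG.measurable) fun x => hq1 _)
          (hρ.continuous_orbitAverage_smul (hq.comp hφG.measurable) fun x => hq1 _)
  · intro h D hD
    have := hD.isMarkovKernel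
    exact ae_iSup_conjDisintegration_eq_one hν.quasiInvariant hη.quasiInvariant hD.bind_eq hπ
      hD.concentrated fun φ hφ hφ1 =>
        essContracts_of_orbitAverage hν.quasiInvariant hη.quasiInvariant D hD.bind_eq hφ hφ1
          fun ρ hρ => essContracts_orbitAverage_of_models hν hη hπ h hD hρ hφ hφ1
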